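/- **Conventions.** $\lambda$ is Lebesgue measure on $\mathbb{R}^2$, $B_r(0)$ the closed ball of radius $r$ about the origin, $\delta_M=\sum_{x\in M}\delta_x$ the Dirac comb of a locally finite set $M\subset\mathbb{R}^2$. The autocorrelation of a locally finite positive measure $\omega$ on $\mathbb{R}^2$ is the vague limit $\gamma_\omega=\lim_{r\to\infty}\frac{1}{\lambda(B_r(0))}\,\omega_r*\widetilde{\omega_r}$ (if it exists), where $\omega_r=\omega|_{B_r(0)}$ and $\widetilde{\omega_r}$ is the image of $\omega_r$ under $x\mapsto -x$. Fourier transforms of measures are taken in the space $\mathcal{S}'(\mathbb{R}^2)$ of tempered distributions, with $\widehat f(k)=\int f(x)e^{-2\pi i k\cdot x}\,dx$ on Schwartz functions; $\widehat{\gamma}_\omega$ is the diffraction measure of $\omega$. For $r\ge 0$, $\mu_r$ is the normalised uniform distribution on the circle $\{x\in\mathbb{R}^2:|x|=r\}$, with $\mu_0=\delta_0$. Let $\mathcal{D}=\{r\ge 0: r^2=m^2+n^2 \text{ for some } m,n\in\mathbb{Z}\}$, and let $\eta(0)=1$ and $\eta(r)=4a(r^2)$ for $r\in\mathcal{D}\setminus\{0\}$,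 where $a(n)$ is the number of ideals of norm $n$ in $\mathbb{Z}[i]$. **Proposition.** (1) Let $N\ge 1$, let $R_1,\dots,R_N\in \mathrm{SO}(2)$, put $\Gamma_j=R_j\mathbb{Z}^2$, and assume $\Gamma_j\cap\Gamma_k=\{0\}$ for $j\ne k$. Let $\omega=\frac1N\sum_{j=1}^N\delta_{\Gamma_j}$. Then the autocorrelation of $\omega$ exists, it is a tempered measure, and $$\gamma_\omega=\frac{N-1}{N}\,\lambda+\sum_{j=1}^N\frac{1}{N^2}\,\delta_{\Gamma_j},\qquad \widehat{\gamma}_\omega=\frac{N-1}{N}\,\delta_0+\frac1N\Bigl(\frac1N\sum_{j=1}^N\widehat{\delta}_{\Gamma_j}\Bigr).$$ Each $\widehat\delta_{\Gamma_j}$, and hence $\widehat\gamma_\omega$, is a positive tempered measure, and the second identity also holds as an identity of measures. (2) Let $(R_j)_{j\ge 0}$ be a sequence in $\mathrm{SO}(2)$, put $\Gamma_j=R_j\mathbb{Z}^2$, and assume $\Gamma_j\cap\Gamma_k=\{0\}$ for $j\ne k$. If $(R_jx)_{j\ge 0}$ is uniformly distributed on the unit circle for some $x$ with $|x|=1$,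 then $$\lim_{N\to\infty}\frac1N\sum_{j=0}^{N-1}\widehat{\delta}_{\Gamma_j}=\sum_{r\in\mathcal{D}}\eta(r)\,\mu_r ,$$ where the right-hand side is a locally finite tempered measure and the limit holds both in $\mathcal{S}'(\mathbb{R}^2)$ (pointwise on Schwartz functions) and in the vague topology. -/

import Mathlib

open MeasureTheory Filter Topology Real
open scoped NNReal ENNReal FourierTransform SchwartzMap

/-- The Euclidean plane `ℝ²`. -/
abbrev Plane : Type := EuclideanSpace ℝ (Fin 2)

/-- The rotation group `SO(2)`, as a group of matrices. -/
abbrev SO2 : Type := Matrix.specialOrthogonalGroup (Fin 2) ℝ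

/-- The action of `R ∈ SO(2)` on the plane, `x ↦ R x`. -/
noncomputable def rotate (R : SO2) (x : Plane) : Plane :=
  Matrix.toEuclideanLin (R : Matrix (Fin 2) (Fin 2) ℝ) x

/-- The square lattice `ℤ²`. -/
def squareLattice : Set Plane := {v | ∀ i, ∃ n : ℤ, v i = n}

/-- The rotated square lattice `R ℤ²`. -/
def rotatedLattice (R : SO2) : Set Plane := rotate R '' squareLattice

/-- The Dirac comb `δ_M = ∑_{x ∈ M} δ_x`. -/
noncomputable def diracComb (M : Set Plane) : Measure Plane :=
  Measure.sum fun x : M => Measure.dirac (x : Plane)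

/-- Convergence of measures in the vague topology, along a filter: the limit (and eventually every
approximant) is locally finite, and the integrals of every continuous, compactly supported function
converge. -/
def VagueTendsto {ι : Type*} (μ : ι → Measure Plane) (l : Filter ι) (ν : Measure Plane) : Prop :=
  (∀ᶠ i in l, IsLocallyFiniteMeasure (μ i)) ∧ IsLocallyFiniteMeasure ν ∧
    ∀ φ : Plane → ℝ, Continuous φ → HasCompactSupport φ →
      Tendsto (fun i => ∫ x, φ x ∂(μ i)) l (𝓝 (∫ x, φ x ∂ν))

/-- The volume-averaged autocorrelation of the restriction of the positive measure `ω` to the closed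
ball `B_r(0)`, that is, `vol(B_r)⁻¹ • (ω_r ∗ ω̃_r)`, where `ω̃_r` is the image of `ω_r` under
`x ↦ -x`. -/
noncomputable def finiteAutocorrelation (ω : Measure Plane) (r : ℝ) : Measure Plane :=
  (volume (Metric.closedBall (0 : Plane) r))⁻¹ •
    ((ω.restrict (Metric.closedBall 0 r)).conv
      ((ω.restrict (Metric.closedBall 0 r)).map (fun x => -x)))

/-- `γ` is the autocorrelation `γ_ω` of the positive measure `ω`: the vague limit, as `r → ∞`, of the
volume-averaged autocorrelations over the balls `B_r(0)` exists and equals `γ`. -/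
def IsAutocorrelation (ω γ : Measure Plane) : Prop :=
  VagueTendsto (finiteAutocorrelation ω) atTop γ

/-- The measure `ν` is the Fourier transform of the measure `μ` in the sense of tempered
distributions. -/
def IsFourierTransform (μ ν : Measure Plane) : Prop :=
  ∃ (_ : μ.HasTemperateGrowth) (_ : ν.HasTemperateGrowth),
    𝓕 μ.toTemperedDistribution = ν.toTemperedDistribution

/-- The measure `ω = (1/N) ∑_j δ_{Γ_j}` attached to `N` rotated square lattices. -/
noncomputable def averagedComb {N : ℕ} (R : Fin N → SO2) : Measure Plane :=
  (1 / N : ℝ≥0) • ∑ j, diracComb (rotatedLattice (R j))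

/-- The measure `((N - 1)/N) λ + ∑_j N⁻² δ_{Γ_j}`. -/
noncomputable def combAutocorrelation {N : ℕ} (R : Fin N → SO2) : Measure Plane :=
  (((N : ℝ≥0) - 1) / N) • (volume : Measure Plane) +
    ∑ j, (1 / (N : ℝ≥0) ^ 2) • diracComb (rotatedLattice (R j))

/-- The normalised uniform distribution `μ_r` on the circle `{x : |x| = r}`; `μ_0 = δ_0`. -/
noncomputable def circleUniform (r : ℝ) : Measure Plane :=
  ENNReal.ofReal (2 * π)⁻¹ •
    (volume.restrict (Set.Ioc 0 (2 * π))).map fun θ : ℝ => !₂[r * cos θ, r * sin θ]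

/-- A sequence in the unit circle is uniformly distributed on it. Every continuous function on the
circle extends to the plane, so it is enough to test with continuous functions on the plane. -/
def IsUniformlyDistributedOnUnitCircle (u : ℕ → Plane) : Prop :=
  (∀ j, ‖u j‖ = 1) ∧ ∀ f : Plane → ℝ, Continuous f →
    Tendsto (fun N : ℕ => (1 / N : ℝ) * ∑ j ∈ Finset.range N, f (u j)) atTop
      (𝓝 (∫ x, f x ∂(circleUniform 1)))

/-- The set of radii of the circular shells of the square lattice. -/
def shellRadii : Set ℝ := {r | 0 ≤ r ∧ ∃ m n : ℤ, r ^ 2 = (m : ℝ) ^ 2 + (n : ℝ) ^ 2}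

/-- `a(n)`: the number of ideals of norm `n ≥ 1` in the ring `ℤ[i]` of Gaussian integers, the norm of
an ideal being the cardinality of its residue class ring. -/
noncomputable def gaussianIdealCount (n : ℕ) : ℕ :=
  {I : Ideal GaussianInt | Nat.card (GaussianInt ⧸ I) = n}.ncard

/-- The shelling number of the square lattice at a radius `r ∈ shellRadii` (where `r²` is a natural
number, so that the floor does nothing): `1` if `r = 0`, and `4 a(r²)` otherwise. -/
noncomputable def shellingNumber (r : ℝ) : ℕ :=
  if r = 0 then 1 else 4 * gaussianIdealCount ⌊r ^ 2⌋₊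

/-- The measure `∑_r η(r) μ_r`, summed over all shell radii of the square lattice. -/
noncomputable def radialComb : Measure Plane :=
  Measure.sum fun r : shellRadii => (shellingNumber r : ℝ≥0∞) • circleUniform r

theorem norm_rotate (R : SO2) (x : Plane) : ‖rotate R x‖ = ‖x‖ := by
  obtain ⟨⟨A, hA⟩, rfl⟩ : ∃ B : SO2, B = R := ⟨R, rfl⟩
  have h := (Matrix.mem_specialOrthogonalGroup_iff.1 hA).1
  have h1 : A.transpose * A = 1 := (Matrix.mem_orthogonalGroup_iff' (Fin 2) ℝ).1 h
  have h00 := congrFun (congrFun h1 0) 0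
  have h01 := congrFun (congrFun h1 0) 1
  have h11 := congrFun (congrFun h1 1) 1
  simp [Matrix.mul_apply, Fin.sum_univ_two] at h00 h01 h11
  rw [EuclideanSpace.norm_eq, EuclideanSpace.norm_eq]
  congr 1
  simp [rotate, Fin.sum_univ_two, Matrix.toLpLin_apply]
  linear_combination (x 0) ^ 2 * h00 + 2 * (x 0) * (x 1) * h01 + (x 1) ^ 2 * h11

theorem temperate_add {μ ν : Measure Plane} (hμ : μ.HasTemperateGrowth)
    (hν : ν.HasTemperateGrowth) : (μ + ν).HasTemperateGrowth := by
  obtain ⟨m, hm⟩ := hμ.exists_integrable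
  obtain ⟨n, hn⟩ := hν.exists_integrable
  refine ⟨m + n, Integrable.add_measure (hm.mono' ?_ ?_) (hn.mono' ?_ ?_)⟩
  any_goals exact Measurable.aestronglyMeasurable (by fun_prop)
  all_goals
    refine ae_of_all _ fun x => ?_
    rw [Real.norm_of_nonneg (by positivity)]
    exact Real.rpow_le_rpow_of_exponent_le (by simp) (by push_cast; linarith)

theorem temperate_smul {μ : Measure Plane} (hμ : μ.HasTemperateGrowth) (c : ℝ≥0) :
    (c • μ).HasTemperateGrowth := by
  obtain ⟨m, hm⟩ := hμ.exists_integrable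
  exact ⟨m, hm.smul_measure_nnreal⟩

theorem temperate_sum {ι : Type*} (s : Finset ι) {μ : ι → Measure Plane}
    (hμ : ∀ i, (μ i).HasTemperateGrowth) : (∑ i ∈ s, μ i).HasTemperateGrowth := by
  classical
  induction s using Finset.induction_on with
  | empty => simpa using (inferInstance : (0 : Measure Plane).HasTemperateGrowth)
  | insert a s ha ih => rw [Finset.sum_insert ha]; exact temperate_add (hμ a) ih

instance temperate_diracComb (R : SO2) :
    (diracComb (rotatedLattice R)).HasTemperateGrowth := by
  refine ⟨4, Measurable.aestronglyMeasurable (by fun_prop), ?_⟩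
  have hs : Summable fun m : ℤ => (1 + |(m : ℝ)|) ^ (-2 : ℝ) := by
    have h := (Real.summable_one_div_int_pow (p := 2)).2 (by norm_num)
    have h' := h.add (summable_of_hasFiniteSupport (f := fun m : ℤ => if m = 0 then (1 : ℝ) else 0)
      ((Set.finite_singleton 0).subset (by intro m; simp)))
    refine h'.of_nonneg_of_le (fun m => by positivity) fun m => ?_
    rcases eq_or_ne m 0 with rfl | hm
    · simp
    · have : (0 : ℝ) < |(m : ℝ)| := abs_pos.2 (by exact_mod_cast hm)
      simp only [hm, if_false, add_zero]
      rw [Real.rpow_neg (by positivity), one_div, ← sq_abs]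
      norm_cast
      push_cast
      gcongr
      linarith
  have hp := hs.mul_of_nonneg hs (fun m => by positivity) (fun m => by positivity)
  rw [HasFiniteIntegral, diracComb, lintegral_sum_measure]
  simp only [lintegral_dirac]
  let g : ℤ × ℤ → rotatedLattice R := fun p =>
    ⟨rotate R !₂[(p.1 : ℝ), (p.2 : ℝ)], _, by
      intro i; fin_cases i
      · exact ⟨p.1, by simp⟩
      · exact ⟨p.2, by simp⟩, rfl⟩
  have hg : Function.Surjective g := by
    rintro ⟨_, v, hv, rfl⟩
    obtain ⟨m, hm⟩ := hv 0
    obtain ⟨n, hn⟩ := hv 1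
    refine ⟨(m, n), Subtype.ext ?_⟩
    have : !₂[(m : ℝ), (n : ℝ)] = v := by
      ext i; fin_cases i
      · simpa using hm.symm
      · simpa using hn.symm
    simp only [g, this]
  refine lt_of_le_of_lt (ENNReal.tsum_le_tsum_comp_of_surjective hg _) ?_
  refine lt_of_le_of_lt (ENNReal.tsum_le_tsum fun p => ?_) hp.tsum_ofReal_lt_top
  rw [← ofReal_norm]
  apply ENNReal.ofReal_le_ofReal
  rw [Real.norm_of_nonneg (by positivity)]
  simp only [g, norm_rotate]
  have h1 : |(p.1 : ℝ)| ≤ ‖(!₂[(p.1 : ℝ), (p.2 : ℝ)] : Plane)‖ := by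
    simpa using PiLp.norm_apply_le (!₂[(p.1 : ℝ), (p.2 : ℝ)] : Plane) 0
  have h2 : |(p.2 : ℝ)| ≤ ‖(!₂[(p.1 : ℝ), (p.2 : ℝ)] : Plane)‖ := by
    simpa using PiLp.norm_apply_le (!₂[(p.1 : ℝ), (p.2 : ℝ)] : Plane) 1
  have e : (-((4 : ℕ) : ℝ)) = -2 + -2 := by norm_num
  rw [e, Real.rpow_add (by positivity)]
  exact mul_le_mul
    (Real.rpow_le_rpow_of_nonpos (by positivity) (by linarith) (by norm_num))
    (Real.rpow_le_rpow_of_nonpos (by positivity) (by linarith) (by norm_num))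
    (by positivity) (by positivity)

instance temperate_combAutocorrelation {N : ℕ} (R : Fin N → SO2) :
    (combAutocorrelation R).HasTemperateGrowth :=
  temperate_add (temperate_smul inferInstance _)
    (temperate_sum _ fun _ => temperate_smul inferInstance _)

/-! Autocorrelation. Tested against `φ`, the averaged convolution is a sum over pairs `(j, k)` of
double sums of `φ (R_j m - R_k n)` over integer vectors of norm at most `r`. Letting `n` run over
the whole lattice costs only terms near the boundary, which are `o(r²)`; the inner sum becomes the
periodization of `φ ∘ R_k` at `R_k⁻¹ R_j m`. For `j = k` this is the constant `δ_{Γ_j}(φ)`. For `j ≠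
k`, a nontrivial character of the torus that is trivial at all points `R_k⁻¹ R_j m` would produce a
nonzero common point of `Γ_j` and `Γ_k`; hence these points equidistribute by Weyl's criterion
(`tendsto_average_torus`) and the mean is `∫ φ`. The weight `1/N²` on `N` diagonal and `N(N-1)`
off-diagonal pairs gives the formula.

Diffraction. Poisson summation (`tsum_fourier_integerPoint`), transported by rotation, makes every
`δ_{Γ_j}` its own Fourier transform, and `λ` is sent to `δ_0`.

Limit of averages. It therefore suffices to average the combs themselves. Plane rotations commute,
so equidistribution of one orbit `R_j x` passes to `R_j y` for every `y`, and the average of `f (R_j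
n)` tends to the mean of `f` over the circle through `n` (`tendsto_average_rotate`). Dominated
convergence sums this over `n`. Grouping by radius, a shell has `η(r)` points because `ℤ[i]` is a
principal ideal domain with four units (`encard_shell`). -/

/-! ### Coordinates on the rotated lattices -/

/-- The point of the plane with integer coordinates `n`. -/
noncomputable def integerPoint (n : Fin 2 → ℤ) : Plane := WithLp.toLp 2 fun i => (n i : ℝ)

@[simp]
theorem integerPoint_apply (n : Fin 2 → ℤ) (i : Fin 2) : integerPoint n i = n i := rfl

theorem integerPoint_add (m n : Fin 2 → ℤ) :
    integerPoint (m + n) = integerPoint m + integerPoint n := by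
  ext i; simp

theorem integerPoint_neg (n : Fin 2 → ℤ) : integerPoint (-n) = -integerPoint n := by
  ext i; simp

@[simp]
theorem integerPoint_zero : integerPoint 0 = 0 := by
  ext i; simp

theorem integerPoint_injective : Function.Injective integerPoint := by
  intro m n h
  funext i
  have := congrArg (fun v : Plane => v i) h
  simpa using this

theorem integerPoint_norm_sq (n : Fin 2 → ℤ) :
    ‖integerPoint n‖ ^ 2 = (n 0 : ℝ) ^ 2 + (n 1 : ℝ) ^ 2 := by
  simp [EuclideanSpace.norm_sq_eq, Fin.sum_univ_two]

theorem norm_le_norm_integerPoint (n : Fin 2 → ℤ) : ‖n‖ ≤ ‖integerPoint n‖ := by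
  refine (pi_norm_le_iff_of_nonneg (norm_nonneg _)).2 fun i => ?_
  simpa [Int.norm_eq_abs] using PiLp.norm_apply_le (integerPoint n) i

theorem squareLattice_eq_range : squareLattice = Set.range integerPoint := by
  ext v
  constructor
  · intro hv
    choose n hn using hv
    exact ⟨n, by ext i; simp [hn]⟩
  · rintro ⟨n, rfl⟩ i
    exact ⟨n i, rfl⟩

/-- A rotation of the plane as a linear isometry. -/
noncomputable def rotateIsometry (R : SO2) : Plane ≃ₗᵢ[ℝ] Plane :=
  LinearIsometry.toLinearIsometryEquiv
    ⟨Matrix.toEuclideanLin (R : Matrix (Fin 2) (Fin 2) ℝ), norm_rotate R⟩ rfl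

@[simp]
theorem coe_rotateIsometry (R : SO2) : ⇑(rotateIsometry R) = rotate R := rfl

theorem rotatedLattice_eq_range (R : SO2) :
    rotatedLattice R = Set.range fun n => rotateIsometry R (integerPoint n) := by
  rw [rotatedLattice, squareLattice_eq_range, ← Set.range_comp]
  rfl

theorem diracComb_rotatedLattice (R : SO2) :
    diracComb (rotatedLattice R) =
      Measure.sum fun n => Measure.dirac (rotateIsometry R (integerPoint n)) := by
  have hinj : Function.Injective fun n => rotateIsometry R (integerPoint n) :=
    (rotateIsometry R).injective.comp integerPoint_injective
  let e := (Equiv.ofInjective _ hinj).trans (Equiv.setCongr (rotatedLattice_eq_range R).symm)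
  ext s hs
  rw [diracComb, Measure.sum_apply _ hs, Measure.sum_apply _ hs, ← e.tsum_eq]
  rfl

/-! ### Quartic decay and summation over shells -/

/-- Continuity together with a decay of order four, which makes sums over a planar lattice
converge. -/
structure HasQuarticDecay (f : Plane → ℂ) : Prop where
  continuous : Continuous f
  exists_bound : ∃ C, 0 ≤ C ∧ ∀ x, ‖f x‖ ≤ C * ((1 + ‖x‖) ^ 4)⁻¹

theorem HasQuarticDecay.of_hasCompactSupport {f : Plane → ℂ} (hf : Continuous f)
    (h : HasCompactSupport f) : HasQuarticDecay f := by
  refine ⟨hf, ?_⟩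
  obtain ⟨C, hC⟩ := (h.mul_right (f' := fun x : Plane => (((1 + ‖x‖) ^ 4 : ℝ) : ℂ))
    ).exists_bound_of_continuous (by fun_prop)
  refine ⟨C, (norm_nonneg _).trans (hC 0), fun x => ?_⟩
  rw [← div_eq_mul_inv, le_div_iff₀ (by positivity)]
  refine le_trans (le_of_eq ?_) (hC x)
  rw [Pi.mul_apply, norm_mul, Complex.norm_real, Real.norm_of_nonneg (by positivity)]

theorem SchwartzMap.hasQuarticDecay (f : 𝓢(Plane, ℂ)) : HasQuarticDecay f := by
  have key := fun x => SchwartzMap.one_add_le_sup_seminorm_apply (𝕜 := ℂ) (m := (4, 0)) (k := 4)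
    (n := 0) le_rfl le_rfl f x
  refine ⟨f.continuous, _, (by positivity : (0 : ℝ) ≤ _).trans (key 0), fun x => ?_⟩
  rw [← div_eq_mul_inv, le_div_iff₀ (by positivity), mul_comm]
  simpa using key x

theorem HasQuarticDecay.comp_isometry {f : Plane → ℂ} (hf : HasQuarticDecay f)
    (A : Plane ≃ₗᵢ[ℝ] Plane) : HasQuarticDecay (f ∘ A) := by
  obtain ⟨C, hC, h⟩ := hf.exists_bound
  exact ⟨hf.continuous.comp A.continuous, C, hC, fun x => by simpa using h (A x)⟩

theorem summable_quartic : Summable fun n => ((1 + ‖integerPoint n‖) ^ 4)⁻¹ := by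
  -- The indicator of `0` covers the term `n = 0`, where `‖n‖ ^ (-4)` has the value `0`.
  have h := (EisensteinSeries.summable_one_div_norm_rpow (k := 4) (by norm_num)).add
    (summable_of_hasFiniteSupport (f := fun n : Fin 2 → ℤ => if n = 0 then (1 : ℝ) else 0)
      ((Set.finite_singleton 0).subset (by intro m; simp)))
  refine h.of_nonneg_of_le (fun n => by positivity) fun n => ?_
  rcases eq_or_ne n 0 with rfl | hn
  · simp
  · have : 0 < ‖n‖ := norm_pos_iff.2 hn
    simp only [hn, if_false, add_zero]
    rw [Real.rpow_neg (by positivity)]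
    norm_cast
    gcongr
    have := norm_le_norm_integerPoint n
    linarith

section Shells

variable {μ : (Fin 2 → ℤ) → Measure Plane} [∀ n, IsProbabilityMeasure (μ n)]

/-- The family `μ` is kept general so that one argument serves both Dirac masses at rotated lattice
points and uniform measures on circles: the decay bound depends only on the norm, which is constant
on each shell. -/
theorem integrable_shell (hμ : ∀ n, ∀ᵐ x ∂(μ n), ‖x‖ = ‖integerPoint n‖) {f : Plane → ℂ}
    (hf : HasQuarticDecay f) (n : Fin 2 → ℤ) : Integrable f (μ n) := by
  obtain ⟨C, hC, h⟩ := hf.exists_bound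
  refine Integrable.of_bound hf.continuous.aestronglyMeasurable
    (C * ((1 + ‖integerPoint n‖) ^ 4)⁻¹) ?_
  filter_upwards [hμ n] with x hx
  rw [← hx]
  exact h x

theorem integrable_sum_shells (hμ : ∀ n, ∀ᵐ x ∂(μ n), ‖x‖ = ‖integerPoint n‖) {f : Plane → ℂ}
    (hf : HasQuarticDecay f) : Integrable f (Measure.sum μ) := by
  obtain ⟨C, hC, h⟩ := hf.exists_bound
  refine integrable_sum_measure (integrable_shell hμ hf)
    ((summable_quartic.mul_left C).of_nonneg_of_le
      (fun n => integral_nonneg fun x => norm_nonneg _) fun n => ?_)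
  refine (integral_mono_of_nonneg (ae_of_all _ fun x => norm_nonneg _)
    (integrable_const (C * ((1 + ‖integerPoint n‖) ^ 4)⁻¹)) ?_).trans_eq (by simp)
  filter_upwards [hμ n] with x hx
  rw [← hx]
  exact h x

theorem hasSum_integral_shells (hμ : ∀ n, ∀ᵐ x ∂(μ n), ‖x‖ = ‖integerPoint n‖) {f : Plane → ℂ}
    (hf : HasQuarticDecay f) :
    HasSum (fun n => ∫ x, f x ∂(μ n)) (∫ x, f x ∂(Measure.sum μ)) :=
  hasSum_integral_measure (integrable_sum_shells hμ hf)

theorem hasTemperateGrowth_sum_shells (hμ : ∀ n, ∀ᵐ x ∂(μ n), ‖x‖ = ‖integerPoint n‖) :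
    (Measure.sum μ).HasTemperateGrowth := by
  have hc : Continuous fun x : Plane => (((1 + ‖x‖) ^ 4)⁻¹ : ℝ) := by
    refine Continuous.inv₀ (by fun_prop) fun x => by positivity
  have hd : HasQuarticDecay fun x : Plane => ((((1 + ‖x‖) ^ 4)⁻¹ : ℝ) : ℂ) := by
    refine ⟨by fun_prop, 1, zero_le_one, fun x => ?_⟩
    rw [Complex.norm_real, one_mul, Real.norm_of_nonneg (by positivity)]
  refine ⟨4, ((integrable_sum_shells hμ hd).norm).congr (ae_of_all _ fun x => ?_)⟩
  simp only [Complex.norm_real]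
  rw [Real.norm_of_nonneg (by positivity), Real.rpow_neg (by positivity)]
  norm_cast

end Shells

/-- Near `x` the weight exceeds half its value at `x`, and an integrable function exceeds a positive
level only on a set of finite measure. -/
theorem isLocallyFiniteMeasure_of_hasTemperateGrowth {μ : Measure Plane}
    (hμ : μ.HasTemperateGrowth) : IsLocallyFiniteMeasure μ := by
  obtain ⟨n, hn⟩ := hμ.exists_integrable
  have hc : Continuous fun x : Plane => (1 + ‖x‖) ^ (-(n : ℝ)) :=
    Continuous.rpow_const (by fun_prop) fun x => Or.inl (by positivity)
  have hpos : ∀ x : Plane, 0 < (1 + ‖x‖) ^ (-(n : ℝ)) := fun x => by positivity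
  refine ⟨fun x => ⟨{y | (1 + ‖x‖) ^ (-(n : ℝ)) / 2 < (1 + ‖y‖) ^ (-(n : ℝ))},
    (isOpen_lt continuous_const hc).mem_nhds (half_lt_self (hpos x)), ?_⟩⟩
  refine lt_of_le_of_lt (measure_mono ?_) (hn.measure_norm_ge_lt_top (half_pos (hpos x)))
  intro y hy
  rw [Set.mem_ofPred_eq] at hy ⊢
  exact hy.le.trans (le_abs_self _)

theorem dirac_shell (A : Plane ≃ₗᵢ[ℝ] Plane) (n : Fin 2 → ℤ) :
    ∀ᵐ x ∂(Measure.dirac (A (integerPoint n))), ‖x‖ = ‖integerPoint n‖ := by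
  rw [ae_dirac_eq]
  simp

theorem hasSum_integral_diracComb (R : SO2) {f : Plane → ℂ} (hf : HasQuarticDecay f) :
    HasSum (fun n => f (rotateIsometry R (integerPoint n)))
      (∫ x, f x ∂(diracComb (rotatedLattice R))) := by
  rw [diracComb_rotatedLattice]
  simpa [integral_dirac] using! hasSum_integral_shells (dirac_shell (rotateIsometry R)) hf

theorem integrable_diracComb (R : SO2) {f : Plane → ℂ} (hf : HasQuarticDecay f) :
    Integrable f (diracComb (rotatedLattice R)) := by
  rw [diracComb_rotatedLattice]
  exact integrable_sum_shells (dirac_shell (rotateIsometry R)) hf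

/-! ### Gaussian integers and the shelling numbers -/

/-- The Gaussian integers as the free module on `1` and `i`. -/
def gaussianEquiv : GaussianInt ≃ₗ[ℤ] (Fin 2 → ℤ) where
  toFun z := ![z.re, z.im]
  invFun n := ⟨n 0, n 1⟩
  map_add' z w := by ext i; fin_cases i <;> simp
  map_smul' a z := by ext i; fin_cases i <;> simp
  left_inv z := rfl
  right_inv n := by ext i; fin_cases i <;> simp

/-- The index of a principal ideal is the absolute determinant of multiplication by its generator,
here computed in the basis `1, i`. -/
theorem natCard_gaussianInt_quotient_span (z : GaussianInt) :
    Nat.card (GaussianInt ⧸ Ideal.span {z}) = z.norm.natAbs := by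
  let b := Module.Basis.ofEquivFun gaussianEquiv
  have : Module.Free ℤ GaussianInt := Module.Free.of_basis b
  have : Module.Finite ℤ GaussianInt := Module.Finite.of_basis b
  have hb0 : b 0 = 1 := by
    simp only [b, Module.Basis.coe_ofEquivFun]
    rfl
  have hb1 : b 1 = ⟨0, 1⟩ := by
    simp only [b, Module.Basis.coe_ofEquivFun]
    rfl
  have hr : ∀ (w : GaussianInt) (i : Fin 2), b.repr w i = ![w.re, w.im] i := fun w i => by
    rw [← Module.Basis.equivFun_apply]
    simp only [b, Module.Basis.equivFun_ofEquivFun]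
    rfl
  have h := Ideal.absNorm_span_singleton z
  rw [Ideal.absNorm_apply, Submodule.cardQuot_apply, Algebra.norm_eq_matrix_det b,
    Matrix.det_fin_two] at h
  simp only [Algebra.leftMulMatrix_eq_repr_mul, hr, hb0, hb1] at h
  rw [h, Zsqrtd.norm_def]
  congr 1
  simp

theorem enatCard_gaussianInt_units : ENat.card GaussianIntˣ = 4 := by
  have h : Set.BijOn (fun u : GaussianIntˣ => (u : GaussianInt)) Set.univ
      ({⟨1, 0⟩, ⟨-1, 0⟩, ⟨0, 1⟩, ⟨0, -1⟩} : Finset GaussianInt) := by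
    refine ⟨fun u _ => ?_, fun u _ v _ h => Units.ext h, fun z hz => ?_⟩
    · have hu := Zsqrtd.norm_eq_one_iff.2 u.isUnit
      simp only
      generalize (u : GaussianInt) = z at hu ⊢
      obtain ⟨a, b⟩ := z
      have h1 : a * a + b * b = 1 := by
        have := GaussianInt.abs_natCast_norm ⟨a, b⟩
        rw [hu, Zsqrtd.norm_def] at this
        simp only at this
        push_cast at this
        linarith
      have ha : a ≤ 1 := by nlinarith
      have ha' : -1 ≤ a := by nlinarith
      have hb : b ≤ 1 := by nlinarith
      have hb' : -1 ≤ b := by nlinarith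
      interval_cases a <;> interval_cases b <;> simp_all
    · have : IsUnit z := by
        rw [← Zsqrtd.norm_eq_one_iff]
        simp only [Finset.coe_insert, Finset.coe_singleton, Set.mem_insert_iff,
          Set.mem_singleton_iff] at hz
        rcases hz with rfl | rfl | rfl | rfl <;> rfl
      exact ⟨this.unit, Set.mem_univ _, rfl⟩
  rw [← Set.encard_univ, Set.encard_congr (Set.BijOn.equiv _ h), Set.encard_coe_eq_coe_finsetCard]
  rfl

/-- Every ideal is principal, so an element of norm `k` is a chosen generator of its ideal times a
unique unit. Counting with `encard` postpones the question of finiteness. -/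
theorem encard_gaussianInt_norm_eq {k : ℕ} (hk : k ≠ 0) :
    {z : GaussianInt | z.norm.natAbs = k}.encard =
      4 * {I : Ideal GaussianInt | Nat.card (GaussianInt ⧸ I) = k}.encard := by
  let T : Set (Ideal GaussianInt) := {I | Nat.card (GaussianInt ⧸ I) = k}
  have hgen : ∀ I : Ideal GaussianInt, Ideal.span {Submodule.IsPrincipal.generator I} = I :=
    fun I => Ideal.span_singleton_generator I
  have hne : ∀ I ∈ T, Submodule.IsPrincipal.generator I ≠ 0 := by
    intro I hI h0
    have h1 : Nat.card (GaussianInt ⧸ I) = k := hI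
    rw [← hgen I, natCard_gaussianInt_quotient_span, h0] at h1
    exact hk (by simpa using h1.symm)
  have h : Set.BijOn (fun p : GaussianIntˣ × Ideal GaussianInt =>
      Submodule.IsPrincipal.generator p.2 * (p.1 : GaussianInt)) (Set.univ ×ˢ T)
      {z : GaussianInt | z.norm.natAbs = k} := by
    refine ⟨?_, ?_, ?_⟩
    · rintro ⟨u, I⟩ ⟨-, hI⟩
      have h1 : Nat.card (GaussianInt ⧸ I) = k := hI
      rw [← hgen I, natCard_gaussianInt_quotient_span] at h1
      simp [Zsqrtd.norm_mul, Int.natAbs_mul, h1, Zsqrtd.norm_eq_one_iff.2 u.isUnit]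
    · rintro ⟨u, I⟩ ⟨-, hI⟩ ⟨v, J⟩ ⟨-, hJ⟩ huv
      simp only at huv
      have hIJ : I = J := by
        rw [← hgen I, ← hgen J, Ideal.span_singleton_eq_span_singleton]
        exact ⟨u * v⁻¹, by rw [Units.val_mul, ← mul_assoc, huv, mul_assoc]; simp⟩
      subst hIJ
      have := mul_left_cancel₀ (hne I hI) huv
      simpa using Units.ext this
    · intro z hz
      have hz' : z.norm.natAbs = k := hz
      have : Associated (Submodule.IsPrincipal.generator (Ideal.span {z})) z := by
        rw [← Ideal.span_singleton_eq_span_singleton, hgen]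
      obtain ⟨u, hu⟩ := this
      exact ⟨(u, Ideal.span {z}), ⟨Set.mem_univ _,
        (natCard_gaussianInt_quotient_span z).trans hz'⟩, hu⟩
  rw [← Set.encard_congr (Set.BijOn.equiv _ h), Set.encard_prod, Set.encard_univ,
    enatCard_gaussianInt_units]

theorem finite_integerPoint_norm_le (r : ℝ) : {n | ‖integerPoint n‖ ≤ r}.Finite := by
  refine ((isCompact_closedBall (0 : Fin 2 → ℤ) r).finite_of_discrete).subset fun n hn => ?_
  rw [mem_closedBall_zero_iff]
  exact (norm_le_norm_integerPoint n).trans hn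

theorem encard_shell {r : ℝ} (hr : r ∈ shellRadii) :
    {n | ‖integerPoint n‖ = r}.encard = shellingNumber r := by
  obtain ⟨hr0, a, b, hab⟩ := hr
  rcases eq_or_ne r 0 with rfl | hne
  · have : {n | ‖integerPoint n‖ = 0} = {0} := by
      ext n
      simp [← integerPoint_injective.eq_iff]
    rw [this]
    simp [shellingNumber]
  · obtain ⟨k, hk⟩ : ∃ k : ℕ, r ^ 2 = k :=
      ⟨(a ^ 2 + b ^ 2).natAbs, by
        rw [hab, Nat.cast_natAbs, abs_of_nonneg (by positivity)]; push_cast; rfl⟩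
    have hk0 : k ≠ 0 := by
      rintro rfl
      simp at hk
      exact hne hk
    have hset : {n | ‖integerPoint n‖ = r} =
        gaussianEquiv '' {z : GaussianInt | z.norm.natAbs = k} := by
      ext n
      rw [gaussianEquiv.image_eq_preimage_symm, Set.mem_preimage, Set.mem_ofPred_eq,
        Set.mem_ofPred_eq, ← sq_eq_sq₀ (norm_nonneg _) hr0, hk, integerPoint_norm_sq]
      have h1 := GaussianInt.abs_natCast_norm (gaussianEquiv.symm n)
      have h2 : (gaussianEquiv.symm n).norm = n 0 ^ 2 + n 1 ^ 2 := by
        have h3 : gaussianEquiv.symm n = ⟨n 0, n 1⟩ := rfl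
        rw [h3, Zsqrtd.norm_def]
        ring
      rw [h2] at h1 ⊢
      rw [← Int.natCast_inj, h1]
      norm_cast
    have hfin : {n | ‖integerPoint n‖ = r}.encard ≠ ⊤ := by
      rw [Set.encard_ne_top_iff]
      exact (finite_integerPoint_norm_le r).subset fun n hn => le_of_eq hn
    rw [hset, gaussianEquiv.injective.encard_image, encard_gaussianInt_norm_eq hk0] at hfin ⊢
    rw [shellingNumber, if_neg hne, hk, Nat.floor_natCast, gaussianIdealCount]
    -- Infinitely many ideals of norm `k` would make the shell infinite; so `ncard` is the true
    -- count.
    have hT : {I : Ideal GaussianInt | Nat.card (GaussianInt ⧸ I) = k}.Finite := by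
      rw [← Set.encard_ne_top_iff]
      intro h
      rw [h] at hfin
      exact hfin rfl
    rw [← hT.cast_ncard_eq]
    norm_cast

/-! ### Uniform measures on circles and the radial comb -/

theorem integral_circleUniform (f : Plane → ℂ) (hf : Continuous f) (r : ℝ) :
    ∫ x, f x ∂(circleUniform r) =
      ((2 * π)⁻¹ : ℝ) • ∫ θ in (0 : ℝ)..(2 * π), f !₂[r * cos θ, r * sin θ] := by
  rw [circleUniform, integral_smul_measure, ENNReal.toReal_ofReal (by positivity),
    integral_map (by fun_prop) hf.aestronglyMeasurable,
    intervalIntegral.integral_of_le (by positivity)]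

instance (r : ℝ) : IsProbabilityMeasure (circleUniform r) := by
  refine ⟨?_⟩
  rw [circleUniform, Measure.smul_apply, Measure.map_apply (by fun_prop) MeasurableSet.univ]
  simp only [Set.preimage_univ, Measure.restrict_apply_univ, Real.volume_Ioc, smul_eq_mul, sub_zero]
  rw [← ENNReal.ofReal_mul (by positivity), inv_mul_cancel₀ (by positivity), ENNReal.ofReal_one]

theorem norm_circle_param (r θ : ℝ) : ‖(!₂[r * cos θ, r * sin θ] : Plane)‖ = |r| := by
  rw [EuclideanSpace.norm_eq, ← Real.sqrt_sq_eq_abs]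
  congr 1
  simp only [Fin.sum_univ_two, Real.norm_eq_abs, sq_abs]
  simp only [Matrix.cons_val_zero, Matrix.cons_val_one]
  linear_combination r ^ 2 * cos_sq_add_sin_sq θ

theorem ae_norm_circleUniform (r : ℝ) : ∀ᵐ x ∂(circleUniform r), ‖x‖ = |r| := by
  refine Measure.ae_smul_measure ?_ _
  rw [ae_map_iff (by fun_prop) (measurableSet_eq_fun (by fun_prop) (by fun_prop))]
  exact ae_of_all _ fun θ => norm_circle_param r θ

theorem circleUniform_shell (n : Fin 2 → ℤ) :
    ∀ᵐ x ∂(circleUniform ‖integerPoint n‖), ‖x‖ = ‖integerPoint n‖ := by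
  simpa using ae_norm_circleUniform ‖integerPoint n‖

/-- Indexing by lattice points instead of radii absorbs the multiplicity `η(r)` and puts the measure
in the same form as a rotated Dirac comb, so the two can be compared term by term. -/
theorem radialComb_eq_sum :
    radialComb = Measure.sum fun n => circleUniform ‖integerPoint n‖ := by
  ext s hs
  let g : (Fin 2 → ℤ) → shellRadii := fun n =>
    ⟨‖integerPoint n‖, norm_nonneg _, n 0, n 1, integerPoint_norm_sq n⟩
  rw [radialComb, Measure.sum_apply _ hs, Measure.sum_apply _ hs, ← ENNReal.tsum_fiberwise _ g]
  refine tsum_congr fun r => ?_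
  have h : ∀ b : g ⁻¹' {r}, circleUniform ‖integerPoint b‖ s = circleUniform r s := by
    intro b
    rw [← show (g b : ℝ) = r from congrArg Subtype.val b.2]
  rw [tsum_congr h, ENNReal.tsum_set_const, Measure.smul_apply, smul_eq_mul]
  have hset : g ⁻¹' {r} = {n | ‖integerPoint n‖ = r} := by
    ext n
    simp [g, Subtype.ext_iff]
  rw [hset, encard_shell r.2]
  norm_cast

theorem hasTemperateGrowth_radialComb : radialComb.HasTemperateGrowth := by
  rw [radialComb_eq_sum]
  exact hasTemperateGrowth_sum_shells circleUniform_shell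

/-! ### Rotations and the limit of averaged combs -/

/-- The rotation of the plane by the angle `α`. -/
noncomputable def turn (α : ℝ) (v : Plane) : Plane :=
  !₂[cos α * v 0 - sin α * v 1, sin α * v 0 + cos α * v 1]

theorem continuous_turn (α : ℝ) : Continuous (turn α) := by
  unfold turn
  fun_prop

theorem turn_turn (α β : ℝ) (v : Plane) : turn α (turn β v) = turn β (turn α v) := by
  ext i
  fin_cases i <;> simp [turn] <;> ring

theorem turn_smul (α c : ℝ) (v : Plane) : turn α (c • v) = c • turn α v := by
  ext i
  fin_cases i <;> simp [turn] <;> ring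

theorem exists_polar (v : Plane) : ∃ θ, v = ‖v‖ • !₂[cos θ, sin θ] := by
  have h : ‖(⟨v 0, v 1⟩ : ℂ)‖ = ‖v‖ := by
    rw [Complex.norm_eq_sqrt_sq_add_sq, EuclideanSpace.norm_eq]
    simp [Fin.sum_univ_two]
  refine ⟨Complex.arg ⟨v 0, v 1⟩, ?_⟩
  rw [← h]
  ext i
  fin_cases i
  · simp
  · simp

theorem exists_rotate_eq_turn (R : SO2) : ∃ β, ∀ v, rotate R v = turn β v := by
  obtain ⟨A, hA⟩ := R
  have hA' := Matrix.mem_specialOrthogonalGroup_iff.1 hA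
  have h1 : A.transpose * A = 1 := (Matrix.mem_orthogonalGroup_iff' (Fin 2) ℝ).1 hA'.1
  have h00 := congrFun (congrFun h1 0) 0
  have h11 := congrFun (congrFun h1 1) 1
  have hd := hA'.2
  rw [Matrix.det_fin_two] at hd
  simp [Matrix.mul_apply, Fin.sum_univ_two] at h00 h11
  -- The squared entries sum to `2` and the determinant is `1`, so this sum of squares is `2 - 2`.
  have hs : (A 0 0 - A 1 1) ^ 2 + (A 0 1 + A 1 0) ^ 2 = 0 := by
    linear_combination h00 + h11 - 2 * hd
  have e1 : A 1 1 = A 0 0 := by nlinarith [sq_nonneg (A 0 0 - A 1 1), sq_nonneg (A 0 1 + A 1 0)]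
  have e2 : A 0 1 = -A 1 0 := by nlinarith [sq_nonneg (A 0 0 - A 1 1), sq_nonneg (A 0 1 + A 1 0)]
  obtain ⟨β, hβ⟩ := exists_polar !₂[A 0 0, A 1 0]
  have hn : ‖(!₂[A 0 0, A 1 0] : Plane)‖ = 1 := by
    rw [EuclideanSpace.norm_eq, Real.sqrt_eq_one]
    simp [Fin.sum_univ_two]
    linear_combination h00
  rw [hn, one_smul] at hβ
  have c : A 0 0 = cos β := by simpa using congrArg (fun v : Plane => v 0) hβ
  have s : A 1 0 = sin β := by simpa using congrArg (fun v : Plane => v 1) hβ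
  refine ⟨β, fun v => ?_⟩
  ext i
  fin_cases i <;>
    simp [rotate, turn, Matrix.toLpLin_apply, e1, e2, c, s]
  ring

theorem exists_eq_smul_turn {x : Plane} (hx : ‖x‖ = 1) (y : Plane) :
    ∃ α, y = ‖y‖ • turn α x := by
  obtain ⟨θ, hθ⟩ := exists_polar x
  obtain ⟨φ, hφ⟩ := exists_polar y
  refine ⟨φ - θ, ?_⟩
  rw [hx, one_smul] at hθ
  conv_lhs => rw [hφ]
  congr 1
  rw [hθ]
  have h1 := Real.cos_add (φ - θ) θ
  have h2 := Real.sin_add (φ - θ) θ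
  rw [sub_add_cancel] at h1 h2
  ext i
  fin_cases i
  · simpa [turn] using h1
  · simpa [turn] using h2

/-- A turn only shifts the angle, and an integral over a full period does not depend on its starting
point. -/
theorem integral_circleUniform_one_smul_turn {f : Plane → ℂ} (hf : Continuous f) (r α : ℝ) :
    ∫ x, f (r • turn α x) ∂(circleUniform 1) = ∫ x, f x ∂(circleUniform r) := by
  rw [integral_circleUniform (fun x => f (r • turn α x))
    (hf.comp ((continuous_turn α).const_smul r)),
    integral_circleUniform f hf]
  congr 1
  have hp : Function.Periodic (fun θ : ℝ => f !₂[r * cos θ, r * sin θ]) (2 * π) := by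
    intro θ
    simp
  have h := hp.intervalIntegral_add_eq α 0
  rw [zero_add] at h
  have h2 := intervalIntegral.integral_comp_add_left (a := 0) (b := 2 * π)
    (fun θ : ℝ => f !₂[r * cos θ, r * sin θ]) α
  rw [add_zero] at h2
  rw [← h, ← h2]
  refine intervalIntegral.integral_congr fun θ _ => ?_
  congr 1
  ext i
  fin_cases i <;> simp [turn, Real.cos_add, Real.sin_add]

theorem IsUniformlyDistributedOnUnitCircle.tendsto_complex {u : ℕ → Plane}
    (hu : IsUniformlyDistributedOnUnitCircle u) {f : Plane → ℂ} (hf : Continuous f) :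
    Tendsto (fun N : ℕ => (1 / N : ℂ) * ∑ j ∈ Finset.range N, f (u j)) atTop
      (𝓝 (∫ x, f x ∂(circleUniform 1))) := by
  have hi : Integrable f (circleUniform 1) := by
    obtain ⟨C, hC⟩ := (isCompact_closedBall (0 : Plane) 1).exists_bound_of_continuousOn
      hf.continuousOn
    refine Integrable.of_bound hf.aestronglyMeasurable C ?_
    filter_upwards [ae_norm_circleUniform 1] with x hx
    exact hC x (by simp [hx])
  have h1 := hu.2 (fun x => (f x).re) (Complex.continuous_re.comp hf)
  have h2 := hu.2 (fun x => (f x).im) (Complex.continuous_im.comp hf)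
  have h3 := ((Complex.continuous_ofReal.tendsto _).comp h1).add
    (((Complex.continuous_ofReal.tendsto _).comp h2).mul_const Complex.I)
  have h4 := integral_re_add_im hi
  simp only [RCLike.re_to_complex, RCLike.im_to_complex, RCLike.I_to_complex] at h4
  rw [← h4]
  refine h3.congr fun N => ?_
  simp only [Function.comp_apply]
  push_cast
  rw [mul_assoc, ← mul_add, Finset.sum_mul, ← Finset.sum_add_distrib]
  simp only [Complex.re_add_im]

/-- With `y = ‖y‖ • turn α x`, commutativity of rotations gives `f (R_j y) = F (R_j x)` for the
continuous function `F v = f (‖y‖ • turn α v)`, to which the hypothesis on the orbit of `x` applies.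
-/
theorem tendsto_average_rotate {R : ℕ → SO2} {x : Plane} (hx : ‖x‖ = 1)
    (hu : IsUniformlyDistributedOnUnitCircle fun j => rotate (R j) x) {f : Plane → ℂ}
    (hf : Continuous f) (y : Plane) :
    Tendsto (fun N : ℕ => (1 / N : ℂ) * ∑ j ∈ Finset.range N, f (rotate (R j) y)) atTop
      (𝓝 (∫ x, f x ∂(circleUniform ‖y‖))) := by
  obtain ⟨α, hα⟩ := exists_eq_smul_turn hx y
  rw [← integral_circleUniform_one_smul_turn hf ‖y‖ α]
  refine (hu.tendsto_complex (hf.comp ((continuous_turn α).const_smul ‖y‖))).congr fun N => ?_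
  congr 1
  refine Finset.sum_congr rfl fun j _ => ?_
  obtain ⟨β, hβ⟩ := exists_rotate_eq_turn (R j)
  simp only [Function.comp_apply, Pi.smul_apply, hβ]
  conv_rhs => rw [hα]
  rw [turn_smul, turn_turn]

/-- Rotations preserve the norm, so the quartic bound at `n` dominates every average at `n`
uniformly in `N`, and limit and lattice sum may be exchanged. -/
theorem tendsto_average_integral_diracComb {R : ℕ → SO2} {x : Plane} (hx : ‖x‖ = 1)
    (hu : IsUniformlyDistributedOnUnitCircle fun j => rotate (R j) x) {f : Plane → ℂ}
    (hf : HasQuarticDecay f) :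
    Tendsto (fun N : ℕ => (1 / N : ℂ) *
        ∑ j ∈ Finset.range N, ∫ x, f x ∂(diracComb (rotatedLattice (R j)))) atTop
      (𝓝 (∫ x, f x ∂radialComb)) := by
  obtain ⟨C, hC, hb⟩ := hf.exists_bound
  rw [radialComb_eq_sum, ← (hasSum_integral_shells circleUniform_shell hf).tsum_eq]
  have h : ∀ N : ℕ, (1 / N : ℂ) *
      ∑ j ∈ Finset.range N, ∫ x, f x ∂(diracComb (rotatedLattice (R j))) =
      ∑' n, (1 / N : ℂ) * ∑ j ∈ Finset.range N, f (rotate (R j) (integerPoint n)) := fun N =>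
    (((hasSum_sum fun j _ => hasSum_integral_diracComb (R j) hf).mul_left _).tsum_eq).symm
  simp only [h]
  refine tendsto_tsum_of_dominated_convergence (summable_quartic.mul_left C)
    (fun n => tendsto_average_rotate hx hu hf.continuous (integerPoint n))
    (Eventually.of_forall fun N n => ?_)
  have h1 : ∀ j, ‖f (rotate (R j) (integerPoint n))‖ ≤ C * ((1 + ‖integerPoint n‖) ^ 4)⁻¹ :=
    fun j => by simpa [norm_rotate] using hb (rotate (R j) (integerPoint n))
  have h2 : 0 ≤ C * ((1 + ‖integerPoint n‖) ^ 4)⁻¹ := by positivity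
  rw [norm_mul, norm_div, norm_one, Complex.norm_natCast]
  refine (mul_le_mul_of_nonneg_left (norm_sum_le_of_le _ fun j _ => h1 j) (by positivity)).trans ?_
  rw [Finset.sum_const, Finset.card_range, nsmul_eq_mul, ← mul_assoc]
  refine mul_le_of_le_one_left h2 ?_
  rw [one_div]
  -- This includes `N = 0`, where the inverse is `0`.
  exact inv_mul_le_one

/-! ### Periodization and Poisson summation -/

/-- Peetre's inequality, from `1 + ‖y‖ ≤ (1 + ‖x‖) (1 + ‖x + y‖)`. It bounds lattice translates
uniformly for `x` in a bounded set. -/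
theorem quartic_add_le (x y : Plane) :
    ((1 + ‖x + y‖) ^ 4)⁻¹ ≤ (1 + ‖x‖) ^ 4 * ((1 + ‖y‖) ^ 4)⁻¹ := by
  rw [← div_eq_mul_inv, le_div_iff₀ (by positivity), inv_mul_le_iff₀ (by positivity), ← mul_pow]
  have h : ‖y‖ ≤ ‖x + y‖ + ‖x‖ := by
    simpa using norm_sub_le (x + y) x
  gcongr
  nlinarith [norm_nonneg x, norm_nonneg (x + y), mul_nonneg (norm_nonneg (x + y)) (norm_nonneg x)]

namespace HasQuarticDecay

variable {f : Plane → ℂ}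

theorem integrable (hf : HasQuarticDecay f) : Integrable f := by
  obtain ⟨C, -, h⟩ := hf.exists_bound
  have hi : Integrable fun x : Plane => C * (1 + ‖x‖) ^ (-(4 : ℝ)) :=
    (integrable_one_add_norm (by simp; norm_num)).const_mul C
  refine hi.mono' hf.continuous.aestronglyMeasurable (ae_of_all _ fun x => (h x).trans_eq ?_)
  rw [Real.rpow_neg (by positivity)]
  norm_cast

theorem exists_summable_bound (hf : HasQuarticDecay f) (s : ℝ) :
    ∃ u : (Fin 2 → ℤ) → ℝ, Summable u ∧
      ∀ n, ∀ x : Plane, ‖x‖ ≤ s → ‖f (x + integerPoint n)‖ ≤ u n := by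
  obtain ⟨C, hC, h⟩ := hf.exists_bound
  refine ⟨fun n => C * ((1 + s) ^ 4 * ((1 + ‖integerPoint n‖) ^ 4)⁻¹),
    (summable_quartic.mul_left _).mul_left _, fun n x hx => (h _).trans ?_⟩
  have := quartic_add_le x (integerPoint n)
  refine mul_le_mul_of_nonneg_left (this.trans ?_) hC
  gcongr

theorem summable_add (hf : HasQuarticDecay f) (x : Plane) :
    Summable fun n => f (x + integerPoint n) := by
  obtain ⟨u, hu, h⟩ := hf.exists_summable_bound ‖x‖
  exact .of_norm_bounded hu fun n => h n x le_rfl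

end HasQuarticDecay

/-- The sum of the translates of `f` by the square lattice. -/
noncomputable def periodization (f : Plane → ℂ) (x : Plane) : ℂ := ∑' n, f (x + integerPoint n)

theorem periodization_add_integerPoint (f : Plane → ℂ) (x : Plane) (m : Fin 2 → ℤ) :
    periodization f (x + integerPoint m) = periodization f x := by
  rw [periodization, periodization, ← (Equiv.addLeft m).tsum_eq fun n => f (x + integerPoint n)]
  refine tsum_congr fun n => ?_
  rw [Equiv.coe_addLeft, integerPoint_add, add_assoc]

theorem continuous_periodization {f : Plane → ℂ} (hf : HasQuarticDecay f) :
    Continuous (periodization f) := by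
  rw [continuous_iff_continuousAt]
  intro x
  obtain ⟨u, hu, h⟩ := hf.exists_summable_bound (‖x‖ + 1)
  have hc : ContinuousOn (periodization f) (Metric.closedBall 0 (‖x‖ + 1)) := by
    refine continuousOn_tsum (fun n => (hf.continuous.comp (by fun_prop)).continuousOn) hu
      fun n y hy => h n y (by simpa using hy)
  refine hc.continuousAt (Metric.closedBall_mem_nhds_of_mem ?_)
  simp

/-- The projection of the plane onto the torus `ℝ² / ℤ²`. -/
def toTorus : C(Plane, UnitAddTorus (Fin 2)) where
  toFun x := fun i => (x i : UnitAddCircle)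
  continuous_toFun := by fun_prop

theorem toTorus_apply (x : Plane) : toTorus x = fun i => (x i : UnitAddCircle) := rfl

/-- Products of quotient maps need not be quotient maps, but products of open ones are. This lets
continuous periodic functions descend to the torus. -/
theorem isQuotientMap_toTorus : IsQuotientMap toTorus := by
  have h1 : IsOpenQuotientMap (Pi.map fun (_ : Fin 2) (t : ℝ) => (t : UnitAddCircle)) :=
    IsOpenQuotientMap.piMap fun _ => QuotientAddGroup.isOpenQuotientMap_mk
  exact (h1.comp (EuclideanSpace.equiv (Fin 2) ℝ).toHomeomorph.isOpenQuotientMap).isQuotientMap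

theorem exists_of_toTorus_eq {x y : Plane} (h : toTorus x = toTorus y) :
    ∃ n, y = x + integerPoint n := by
  have h1 : ∀ i, ∃ n : ℤ, y i = x i + n := fun i => by
    have h2 : (x i : UnitAddCircle) = y i := congrFun h i
    rw [QuotientAddGroup.eq, AddSubgroup.mem_zmultiples_iff] at h2
    obtain ⟨n, hn⟩ := h2
    exact ⟨n, by simp at hn; linarith⟩
  choose n hn using h1
  exact ⟨n, by ext i; simp [hn]⟩

theorem toTorus_add_integerPoint (x : Plane) (n : Fin 2 → ℤ) :
    toTorus (x + integerPoint n) = toTorus x := by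
  funext i
  rw [toTorus_apply, toTorus_apply, QuotientAddGroup.eq, AddSubgroup.mem_zmultiples_iff]
  exact ⟨-n i, by simp⟩

theorem factorsThrough_periodization (f : Plane → ℂ) :
    Function.FactorsThrough (periodization f) toTorus := fun x y h => by
  obtain ⟨n, rfl⟩ := exists_of_toTorus_eq h
  exact (periodization_add_integerPoint f x n).symm

/-- The periodization of `f` as a continuous function on the torus. -/
noncomputable def torusPeriodization (f : Plane → ℂ) (hf : HasQuarticDecay f) :
    C(UnitAddTorus (Fin 2), ℂ) :=
  isQuotientMap_toTorus.lift ⟨periodization f, continuous_periodization hf⟩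
    (factorsThrough_periodization f)

theorem torusPeriodization_toTorus (f : Plane → ℂ) (hf : HasQuarticDecay f) (x : Plane) :
    torusPeriodization f hf (toTorus x) = periodization f x :=
  DFunLike.congr_fun (isQuotientMap_toTorus.lift_comp
    ⟨periodization f, continuous_periodization hf⟩ (factorsThrough_periodization f)) x

/-- The half-open unit square. -/
def unitSquare : Set Plane := {x | ∀ i, x i ∈ Set.Ioc (0 : ℝ) 1}

theorem measurableSet_unitSquare : MeasurableSet unitSquare := by
  have : unitSquare = ⋂ i, (fun x : Plane => x i) ⁻¹' Set.Ioc (0 : ℝ) 1 := by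
    ext x; simp [unitSquare]
  rw [this]
  exact MeasurableSet.iInter fun i => (by fun_prop : Measurable fun x : Plane => x i)
    measurableSet_Ioc

theorem norm_le_two_of_mem_unitSquare {x : Plane} (hx : x ∈ unitSquare) : ‖x‖ ≤ 2 := by
  have h0 := hx 0
  have h1 := hx 1
  rw [Set.mem_Ioc] at h0 h1
  rw [EuclideanSpace.norm_eq, Real.sqrt_le_left (by norm_num)]
  simp only [Fin.sum_univ_two, Real.norm_eq_abs, sq_abs]
  nlinarith

theorem iUnion_unitSquare :
    ⋃ n, (fun x => x - integerPoint n) ⁻¹' unitSquare = Set.univ := by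
  -- The square omits `0` and contains `1` in each coordinate, hence `⌈x i⌉ - 1` instead of the
  -- floor.
  refine Set.eq_univ_of_forall fun x => Set.mem_iUnion.2 ⟨fun i => ⌈x i⌉ - 1, fun i => ?_⟩
  have h1 := Int.le_ceil (x i)
  have h2 := Int.ceil_lt_add_one (x i)
  simp only [PiLp.sub_apply, integerPoint_apply, Set.mem_Ioc]
  push_cast
  constructor <;> linarith

theorem pairwise_disjoint_unitSquare :
    Pairwise (Function.onFun Disjoint fun n => (fun x => x - integerPoint n) ⁻¹' unitSquare) := by
  intro m n hmn
  refine Set.disjoint_left.2 fun x hx hy => hmn (funext fun i => ?_)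
  have h1 := hx i
  have h2 := hy i
  simp only [PiLp.sub_apply, integerPoint_apply, Set.mem_Ioc] at h1 h2
  have h3 : (m i : ℝ) < n i + 1 := by linarith
  have h4 : (n i : ℝ) < m i + 1 := by linarith
  norm_cast at h3 h4
  omega

/-- Unfolding: the integer translates of the unit square tile the plane. -/
theorem setIntegral_unitSquare_periodization {f : Plane → ℂ} (hf : HasQuarticDecay f) :
    ∫ x in unitSquare, periodization f x = ∫ x, f x := by
  obtain ⟨u, hu, h⟩ := hf.exists_summable_bound 2
  have hi : ∀ n, Integrable (fun x => f (x + integerPoint n)) := fun n =>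
    hf.integrable.comp_add_right (integerPoint n)
  have hfin : volume unitSquare ≠ ⊤ := by
    refine ((measure_mono fun x hx => ?_).trans_lt
      (isCompact_closedBall (0 : Plane) 2).measure_lt_top).ne
    simpa using norm_le_two_of_mem_unitSquare hx
  have h1 : HasSum (fun n => ∫ x in unitSquare, f (x + integerPoint n))
      (∫ x in unitSquare, periodization f x) := by
    refine hasSum_integral_of_summable_integral_norm (fun n => (hi n).integrableOn)
      ((hu.mul_right (volume.real unitSquare)).of_nonneg_of_le
        (fun n => integral_nonneg fun x => norm_nonneg _) fun n => ?_)
    refine (Real.le_norm_self _).trans (norm_setIntegral_le_of_norm_le_const hfin.lt_top ?_)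
    intro x hx
    rw [norm_norm]
    exact h n x (norm_le_two_of_mem_unitSquare hx)
  have h2 := hasSum_integral_iUnion
    (fun n => (by fun_prop : Measurable fun x : Plane => x - integerPoint n)
      measurableSet_unitSquare) pairwise_disjoint_unitSquare
    (f := f) (μ := volume) hf.integrable.integrableOn
  rw [iUnion_unitSquare, setIntegral_univ] at h2
  refine h1.unique ?_
  convert! h2 using 2 with n
  have := (measurePreserving_sub_right volume (integerPoint n)).setIntegral_preimage_emb
    (MeasurableEquiv.subRight (integerPoint n)).measurableEmbedding
    (fun x => f (x + integerPoint n)) unitSquare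
  simpa using this.symm

theorem mFourier_toTorus (n : Fin 2 → ℤ) (x : Plane) :
    UnitAddTorus.mFourier n (toTorus x) = 𝐞 (inner ℝ x (integerPoint n)) := by
  rw [UnitAddTorus.mFourier]
  simp only [ContinuousMap.coe_mk, toTorus_apply, fourier_coe_apply, Fin.prod_univ_two,
    Real.fourierChar_apply]
  rw [← Complex.exp_add]
  congr 1
  simp [PiLp.inner_apply, Fin.sum_univ_two]
  ring

theorem mFourierCoeff_eq_setIntegral (G : C(UnitAddTorus (Fin 2), ℂ)) (n : Fin 2 → ℤ) :
    UnitAddTorus.mFourierCoeff G n =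
      ∫ x in unitSquare, UnitAddTorus.mFourier (-n) (toTorus x) * G (toTorus x) := by
  rw [UnitAddTorus.mFourierCoeff_eq_integral _ _ 0]
  have := (PiLp.volume_preserving_toLp (Fin 2)).setIntegral_preimage_emb
    (MeasurableEquiv.toLp 2 (Fin 2 → ℝ)).measurableEmbedding
    (fun x => UnitAddTorus.mFourier (-n) (toTorus x) * G (toTorus x)) unitSquare
  rw [← this]
  simp [unitSquare, toTorus_apply]

/-- A character of integer frequency is periodic, so its product with the periodization of `f` is
the periodization of its product with `f`; unfolding then gives the Fourier integral. -/
theorem mFourierCoeff_torusPeriodization {f : Plane → ℂ} (hf : HasQuarticDecay f)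
    (n : Fin 2 → ℤ) :
    UnitAddTorus.mFourierCoeff (torusPeriodization f hf) n = 𝓕 f (integerPoint n) := by
  have hg : HasQuarticDecay fun x => (𝐞 (-inner ℝ x (integerPoint n)) : ℂ) * f x := by
    obtain ⟨C, hC, h⟩ := hf.exists_bound
    refine ⟨Continuous.mul ?_ hf.continuous, C, hC, fun x => by
      rw [norm_mul, Circle.norm_coe, one_mul]
      exact h x⟩
    exact continuous_subtype_val.comp (Real.continuous_fourierChar.comp (by fun_prop))
  rw [mFourierCoeff_eq_setIntegral, Real.fourier_eq]
  simp only [Circle.smul_def, smul_eq_mul]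
  rw [← setIntegral_unitSquare_periodization hg]
  congr 1
  funext x
  rw [torusPeriodization_toTorus, periodization, periodization, ← tsum_mul_left]
  refine tsum_congr fun m => ?_
  congr 1
  rw [← toTorus_add_integerPoint x m, mFourier_toTorus, integerPoint_neg, inner_neg_right]

/-- The Poisson summation formula for the square lattice. -/
theorem tsum_fourier_integerPoint {f : Plane → ℂ} (hf : HasQuarticDecay f)
    (hf' : HasQuarticDecay (𝓕 f)) :
    ∑' n, 𝓕 f (integerPoint n) = ∑' n, f (integerPoint n) := by
  -- Decay of `𝓕 f` makes the Fourier coefficients summable, so the Fourier series converges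
  -- pointwise; it is evaluated at `0`.
  have hs : Summable (UnitAddTorus.mFourierCoeff (torusPeriodization f hf)) := by
    have := hf'.summable_add 0
    simp only [zero_add, ← mFourierCoeff_torusPeriodization hf] at this
    exact this
  have h := UnitAddTorus.hasSum_mFourier_series_apply_of_summable hs (toTorus 0)
  simp only [mFourierCoeff_torusPeriodization hf, mFourier_toTorus, inner_zero_left,
    AddChar.map_zero_eq_one, Circle.coe_one, smul_eq_mul, mul_one, torusPeriodization_toTorus] at h
  rw [h.tsum_eq]
  simp [periodization]

/-- The Fourier transform commutes with linear isometries, which reduces a rotated lattice to `ℤ²`.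
-/
theorem integral_fourier_diracComb (R : SO2) {f : Plane → ℂ} (hf : HasQuarticDecay f)
    (hf' : HasQuarticDecay (𝓕 f)) :
    ∫ x, 𝓕 f x ∂(diracComb (rotatedLattice R)) = ∫ x, f x ∂(diracComb (rotatedLattice R)) := by
  have h : 𝓕 (f ∘ rotateIsometry R) = 𝓕 f ∘ rotateIsometry R :=
    funext fun x => Real.fourier_comp_linearIsometry _ _ _
  have := tsum_fourier_integerPoint (hf.comp_isometry (rotateIsometry R))
    (by rw [h]; exact hf'.comp_isometry (rotateIsometry R))
  rw [← (hasSum_integral_diracComb R hf).tsum_eq, ← (hasSum_integral_diracComb R hf').tsum_eq]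
  rwa [h] at this

theorem fourier_diracComb (R : SO2) :
    𝓕 (diracComb (rotatedLattice R)).toTemperedDistribution =
      (diracComb (rotatedLattice R)).toTemperedDistribution := by
  ext g
  change ∫ x, (𝓕 g) x ∂(diracComb (rotatedLattice R)) = ∫ x, g x ∂(diracComb (rotatedLattice R))
  have := (𝓕 g).hasQuarticDecay
  rw [SchwartzMap.fourier_coe] at this ⊢
  exact integral_fourier_diracComb R g.hasQuarticDecay this

theorem isFourierTransform_diracComb (R : SO2) :
    IsFourierTransform (diracComb (rotatedLattice R)) (diracComb (rotatedLattice R)) :=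
  ⟨inferInstance, inferInstance, fourier_diracComb R⟩

/-! ### Lattice points in discs and boundary estimates -/

/-- The integer vectors of Euclidean norm at most `r`. -/
noncomputable def latticeBall (r : ℝ) : Finset (Fin 2 → ℤ) :=
  (finite_integerPoint_norm_le r).toFinset

@[simp]
theorem mem_latticeBall {r : ℝ} {n : Fin 2 → ℤ} : n ∈ latticeBall r ↔ ‖integerPoint n‖ ≤ r := by
  simp [latticeBall]

theorem latticeBall_mono {r s : ℝ} (h : r ≤ s) : latticeBall r ⊆ latticeBall s := fun n hn => by
  rw [mem_latticeBall] at hn ⊢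
  exact hn.trans h

-- Lattice points in dilates of the unit disc are asymptotically counted by its area. Convexity
-- gives the null frontier and, as the disc contains `0`, the monotonicity of the dilates.
open scoped Pointwise in
theorem tendsto_card_latticeBall :
    Tendsto (fun r : ℝ => ((latticeBall r).card : ℝ) / r ^ 2) atTop (𝓝 π) := by
  let s : Set (Fin 2 → ℝ) := WithLp.toLp 2 ⁻¹' Metric.closedBall (0 : Plane) 1
  have hs : Convex ℝ s :=
    (convex_closedBall (0 : Plane) 1).linear_preimage
      (WithLp.linearEquiv 2 ℝ (Fin 2 → ℝ)).symm.toLinearMap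
  have hmem : ∀ v, v ∈ s ↔ ‖(WithLp.toLp 2 v : Plane)‖ ≤ 1 := fun v => by simp [s]
  have hb : Bornology.IsBounded s := by
    refine (Metric.isBounded_closedBall (x := (0 : Fin 2 → ℝ)) (r := 1)).subset fun v hv => ?_
    rw [mem_closedBall_zero_iff]
    refine (pi_norm_le_iff_of_nonneg zero_le_one).2 fun i => ?_
    exact (PiLp.norm_apply_le (WithLp.toLp 2 v : Plane) i).trans ((hmem v).1 hv)
  have hm : MeasurableSet s :=
    (PiLp.volume_preserving_toLp (Fin 2)).measurable Metric.isClosed_closedBall.measurableSet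
  have hv : volume.real s = π := by
    rw [measureReal_def, (PiLp.volume_preserving_toLp (Fin 2)).measure_preimage
      Metric.isClosed_closedBall.measurableSet.nullMeasurableSet,
      EuclideanSpace.volume_closedBall_fin_two]
    simp [pi_nonneg]
  have h := tendsto_card_div_pow_atTop_volume' s hb hm (hs.addHaar_frontier volume) ?_
  · rw [hv] at h
    refine h.congr' ?_
    filter_upwards [eventually_gt_atTop 0] with r hr
    rw [Fintype.card_fin]
    congr 2
    have hset : s ∩ r⁻¹ • (Submodule.span ℤ (Set.range (Pi.basisFun ℝ (Fin 2))) : Set (Fin 2 → ℝ)) =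
        (fun (n : Fin 2 → ℤ) (i : Fin 2) => r⁻¹ * (n i : ℝ)) '' (latticeBall r) := by
      ext v
      rw [Set.mem_inter_iff, Set.mem_inv_smul_set_iff₀ hr.ne', SetLike.mem_coe,
        Module.Basis.mem_span_iff_repr_mem, hmem]
      constructor
      · rintro ⟨h1, h2⟩
        choose n hn using h2
        have hn' : ∀ i, (n i : ℝ) = r * v i := fun i => by simpa using hn i
        have hv : (fun i => r⁻¹ * (n i : ℝ)) = v := funext fun i => by rw [hn']; field_simp
        refine ⟨n, ?_, hv⟩
        rw [Finset.mem_coe, mem_latticeBall]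
        have : integerPoint n = r • WithLp.toLp 2 v := by
          ext i; simp [hn']
        rw [this, norm_smul, Real.norm_of_nonneg hr.le]
        exact mul_le_of_le_one_right hr.le h1
      · rintro ⟨n, h1, rfl⟩
        rw [Finset.mem_coe, mem_latticeBall] at h1
        constructor
        · have : (WithLp.toLp 2 (fun i => r⁻¹ * (n i : ℝ)) : Plane) = r⁻¹ • integerPoint n := by
            ext i; simp
          rw [this, norm_smul, Real.norm_of_nonneg (by positivity), inv_mul_le_iff₀ hr, mul_one]
          exact h1
        · exact fun i => ⟨n i, by simp [hr.ne']⟩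
    rw [hset, Nat.card_image_of_injective, Nat.card_coe_set_eq, Set.ncard_coe_finset]
    intro m n hmn
    funext i
    have := congrFun hmn i
    simpa [hr.ne'] using this
  · intro x y hx hxy
    have hs0 : (0 : Fin 2 → ℝ) ∈ s := by simp [hmem]
    have hy : 0 < y := hx.trans_le hxy
    rintro _ ⟨v, hv, rfl⟩
    refine ⟨(x / y) • v, hs.smul_mem_of_zero_mem hs0 hv ⟨by positivity, (div_le_one hy).2 hxy⟩, ?_⟩
    simp only [smul_smul]
    rw [mul_div_cancel₀ _ hy.ne']

theorem tendsto_card_latticeBall_add (c : ℝ) :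
    Tendsto (fun r : ℝ => ((latticeBall (r + c)).card : ℝ) / r ^ 2) atTop (𝓝 π) := by
  have h1 := tendsto_card_latticeBall.comp (tendsto_atTop_add_const_right atTop c tendsto_id)
  have h2 : Tendsto (fun r : ℝ => (1 + c / r) ^ 2) atTop (𝓝 ((1 + 0) ^ 2)) :=
    (tendsto_const_nhds.add (tendsto_const_nhds.div_atTop tendsto_id)).pow 2
  have h3 := h1.mul h2
  rw [add_zero, one_pow, mul_one] at h3
  refine h3.congr' ?_
  filter_upwards [eventually_gt_atTop 0, eventually_gt_atTop (-c)] with r hr hc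
  have : r + c ≠ 0 := by linarith
  simp only [Function.comp_apply, id]
  field_simp

/-- An annulus of fixed width holds `o(r²)` lattice points; all boundary errors are reduced to this.
-/
theorem tendsto_card_latticeBall_sub (c : ℝ) :
    Tendsto (fun r : ℝ => (((latticeBall r).card : ℝ) - (latticeBall (r - c)).card) / r ^ 2)
      atTop (𝓝 0) := by
  have := tendsto_card_latticeBall.sub (tendsto_card_latticeBall_add (-c))
  rw [sub_self] at this
  simpa only [sub_div, ← sub_eq_add_neg] using this

theorem norm_sum_sub_sum_latticeBall_le {S : Finset (Fin 2 → ℤ)} {r s : ℝ}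
    (hS : latticeBall s ⊆ S) (hcard : S.card = (latticeBall r).card) {F : (Fin 2 → ℤ) → ℂ}
    {M : ℝ} (hF : ∀ n, ‖F n‖ ≤ M) :
    ‖∑ n ∈ S, F n - ∑ n ∈ latticeBall s, F n‖ ≤
      M * (((latticeBall r).card : ℝ) - (latticeBall s).card) := by
  classical
  rw [← Finset.sum_sdiff hS, add_sub_cancel_right]
  refine (norm_sum_le_of_le _ fun n _ => hF n).trans_eq ?_
  rw [Finset.sum_const, nsmul_eq_mul, Finset.card_sdiff_of_subset hS,
    Nat.cast_sub (Finset.card_le_card hS), hcard, mul_comm]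

theorem tendsto_average_of_forall_norm_le {F : ℝ → ℂ} {c M : ℝ}
    (hF : ∀ r, ‖F r‖ ≤ M * (((latticeBall r).card : ℝ) - (latticeBall (r - c)).card)) :
    Tendsto (fun r : ℝ => F r / (r : ℂ) ^ 2) atTop (𝓝 0) := by
  have h := (tendsto_card_latticeBall_sub c).const_mul M
  rw [mul_zero] at h
  refine squeeze_zero_norm (fun r => ?_) h
  rw [norm_div, norm_pow, Complex.norm_real, Real.norm_eq_abs, sq_abs, ← mul_div_assoc]
  exact div_le_div_of_nonneg_right (hF r) (sq_nonneg r)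

/-- Translating the ball by `g` multiplies the sum by `χ g`, yet alters it only by boundary terms.
Hence `χ g - 1` times the sum is `o(r²)`. -/
theorem tendsto_average_character {χ : (Fin 2 → ℤ) → ℂ} (hχ : ∀ m n, χ (m + n) = χ m * χ n)
    (hn : ∀ m, ‖χ m‖ = 1) {g : Fin 2 → ℤ} (hg : χ g ≠ 1) :
    Tendsto (fun r : ℝ => (∑ m ∈ latticeBall r, χ m) / (r : ℂ) ^ 2) atTop (𝓝 0) := by
  have hg' : χ g - 1 ≠ 0 := sub_ne_zero.2 hg
  -- The factor `2`: the ball and its translate are each compared with the smaller ball contained in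
  -- both.
  refine tendsto_average_of_forall_norm_le (c := ‖integerPoint g‖) (M := 2 / ‖χ g - 1‖) fun r => ?_
  have hsub : latticeBall (r - ‖integerPoint g‖) ⊆ (latticeBall r).map (addRightEmbedding g) := by
    intro n hn
    rw [mem_latticeBall] at hn
    refine Finset.mem_map.2 ⟨n - g, ?_, by simp⟩
    rw [mem_latticeBall, sub_eq_add_neg, integerPoint_add, integerPoint_neg, ← sub_eq_add_neg]
    linarith [norm_sub_le (integerPoint n) (integerPoint g)]
  have h1 := norm_sum_sub_sum_latticeBall_le (r := r) hsub (Finset.card_map _) (F := χ) (M := 1)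
    fun n => (hn n).le
  have h2 := norm_sum_sub_sum_latticeBall_le (r := r)
    (latticeBall_mono (sub_le_self r (norm_nonneg (integerPoint g)))) rfl (F := χ) (M := 1)
    fun n => (hn n).le
  rw [Finset.sum_map] at h1
  simp only [addRightEmbedding_apply, hχ] at h1
  rw [← Finset.sum_mul] at h1
  have h3 : ‖χ g - 1‖ * ‖∑ m ∈ latticeBall r, χ m‖ ≤
      2 * (((latticeBall r).card : ℝ) - (latticeBall (r - ‖integerPoint g‖)).card) := by
    rw [← norm_mul]
    refine le_trans (le_of_eq ?_) ((norm_sub_le _ _).trans ((add_le_add h1 h2).trans_eq (by ring)))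
    congr 1
    ring
  rw [div_mul_eq_mul_div, le_div_iff₀ (norm_pos_iff.2 hg'), mul_comm]
  exact h3

/-! ### Weyl equidistribution on the torus -/

open UnitAddTorus in
theorem mFourierCoeff_mFourier_zero (k : Fin 2 → ℤ) :
    mFourierCoeff (mFourier k) 0 = if k = 0 then 1 else 0 := by
  classical
  have h := mFourierBasis_repr (mFourierLp 2 k) (0 : Fin 2 → ℤ)
  rw [mFourierCoeff_toLp, ← coe_mFourierBasis, HilbertBasis.repr_self] at h
  rw [← h, lp.single_apply]
  simp [Pi.single_apply, eq_comm]

theorem volume_unitSquare : volume unitSquare = 1 := by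
  have h := mFourierCoeff_eq_setIntegral (UnitAddTorus.mFourier 0) 0
  rw [mFourierCoeff_mFourier_zero, if_pos rfl, neg_zero, UnitAddTorus.mFourier_zero] at h
  simp only [ContinuousMap.one_apply, mul_one, integral_const, measureReal_def,
    Measure.restrict_apply_univ, Complex.real_smul] at h
  have h2 : (volume unitSquare).toReal = 1 := by exact_mod_cast h.symm
  rwa [ENNReal.toReal_eq_one_iff] at h2

theorem integrableOn_unitSquare_comp_toTorus (G : C(UnitAddTorus (Fin 2), ℂ)) :
    IntegrableOn (fun x => G (toTorus x)) unitSquare := by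
  have : IsFiniteMeasure (volume.restrict unitSquare) := ⟨by simp [volume_unitSquare]⟩
  exact Integrable.of_bound (by fun_prop) ‖G‖ (ae_of_all _ fun x => G.norm_coe_le_norm _)

/-- The mean of a continuous function over the torus. -/
noncomputable def torusMean : C(UnitAddTorus (Fin 2), ℂ) →L[ℂ] ℂ :=
  LinearMap.mkContinuous
    { toFun := fun G => ∫ x in unitSquare, G (toTorus x)
      map_add' := fun G H => integral_add (integrableOn_unitSquare_comp_toTorus G)
        (integrableOn_unitSquare_comp_toTorus H)
      map_smul' := fun a G => integral_const_mul a _ } 1 fun G => by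
    have := norm_setIntegral_le_of_norm_le_const (μ := volume) (s := unitSquare) (C := ‖G‖)
      (f := fun x => G (toTorus x)) (by simp [volume_unitSquare]) fun x _ => G.norm_coe_le_norm _
    simpa [measureReal_def, volume_unitSquare] using this

theorem norm_torusMean_le (G : C(UnitAddTorus (Fin 2), ℂ)) : ‖torusMean G‖ ≤ ‖G‖ := by
  simpa using torusMean.le_of_opNorm_le (LinearMap.mkContinuous_norm_le _ zero_le_one _) G

theorem mFourierCoeff_zero_eq_torusMean (G : C(UnitAddTorus (Fin 2), ℂ)) :
    UnitAddTorus.mFourierCoeff G 0 = torusMean G := by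
  rw [mFourierCoeff_eq_setIntegral, neg_zero, UnitAddTorus.mFourier_zero]
  simp only [ContinuousMap.one_apply, one_mul]
  rfl

theorem torusMean_torusPeriodization {f : Plane → ℂ} (hf : HasQuarticDecay f) :
    torusMean (torusPeriodization f hf) = ∫ x, f x := by
  rw [← mFourierCoeff_zero_eq_torusMean, mFourierCoeff_torusPeriodization, Real.fourier_eq]
  simp

theorem exists_int_of_fourierChar_eq_one {t : ℝ} (h : 𝐞 t = 1) : ∃ n : ℤ, t = n := by
  have h1 : ((𝐞 t : Circle) : ℂ) = 1 := by rw [h, Circle.coe_one]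
  rw [Real.fourierChar_apply, Complex.exp_eq_one_iff] at h1
  obtain ⟨n, hn⟩ := h1
  refine ⟨n, ?_⟩
  have h2 : ((2 * π * t : ℝ) : ℂ) = ((n * (2 * π) : ℝ) : ℂ) := by
    apply mul_right_cancel₀ Complex.I_ne_zero
    rw [hn]
    push_cast
    ring
  have h3 : 2 * π * t = n * (2 * π) := by exact_mod_cast h2
  have := pi_pos
  field_simp at h3
  exact h3

-- Weyl's criterion. The character of frequency `k` at `C m` is `𝐞 ⟨m, C⁻¹ k⟩`, a character of `m`
-- that `hC` makes nontrivial for `k ≠ 0`. Trigonometric polynomials follow by linearity, and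
-- continuous functions by uniform density.
open UnitAddTorus in
theorem tendsto_average_torus (C : Plane ≃ₗᵢ[ℝ] Plane)
    (hC : ∀ k, k ≠ 0 → C.symm (integerPoint k) ∉ Set.range integerPoint)
    (G : C(UnitAddTorus (Fin 2), ℂ)) :
    Tendsto (fun r : ℝ => (∑ m ∈ latticeBall r, G (toTorus (C (integerPoint m)))) / (r : ℂ) ^ 2)
      atTop (𝓝 (π * torusMean G)) := by
  have hchar : ∀ k, Tendsto (fun r : ℝ =>
      (∑ m ∈ latticeBall r, mFourier k (toTorus (C (integerPoint m)))) / (r : ℂ) ^ 2)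
      atTop (𝓝 (π * torusMean (mFourier k))) := by
    intro k
    rw [← mFourierCoeff_zero_eq_torusMean, mFourierCoeff_mFourier_zero]
    split_ifs with hk
    · subst hk
      have := (Complex.continuous_ofReal.tendsto _).comp tendsto_card_latticeBall
      simpa [Function.comp_def, mFourier_zero] using this
    · rw [mul_zero]
      have hm : ∀ m, mFourier k (toTorus (C (integerPoint m))) =
          𝐞 (inner ℝ (integerPoint m) (C.symm (integerPoint k))) := fun m => by
        have h := C.inner_map_map (integerPoint m) (C.symm (integerPoint k))
        rw [C.apply_symm_apply] at h
        rw [mFourier_toTorus, h]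
      -- A character trivial on both basis vectors would force `C⁻¹ k` to be integral.
      obtain ⟨i, hi⟩ : ∃ i, 𝐞 (C.symm (integerPoint k) i) ≠ 1 := by
        by_contra! h
        refine hC k hk ?_
        have h2 : ∀ i, ∃ n : ℤ, (C.symm (integerPoint k)) i = n := fun i =>
          exists_int_of_fourierChar_eq_one (h i)
        choose n hn using h2
        exact ⟨n, by ext i; simp [hn]⟩
      refine tendsto_average_character (χ := fun m => mFourier k (toTorus (C (integerPoint m))))
        (g := Pi.single i 1) ?_ ?_ ?_
      · intro m n
        simp only [hm]
        rw [integerPoint_add, inner_add_left, AddChar.map_add_eq_mul, Circle.coe_mul]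
      · intro m
        simp only [hm, Circle.norm_coe]
      · rw [hm]
        have : inner ℝ (integerPoint (Pi.single i 1)) (C.symm (integerPoint k)) =
            C.symm (integerPoint k) i := by
          fin_cases i <;> simp [PiLp.inner_apply, Fin.sum_univ_two]
        rw [this]
        simpa only [ne_eq, Circle.coe_eq_one] using hi
  have hspan : ∀ H ∈ Submodule.span ℂ (Set.range (mFourier (d := Fin 2))), Tendsto (fun r : ℝ =>
      (∑ m ∈ latticeBall r, H (toTorus (C (integerPoint m)))) / (r : ℂ) ^ 2)
      atTop (𝓝 (π * torusMean H)) := by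
    intro H hH
    induction hH using Submodule.span_induction with
    | mem H hH =>
      obtain ⟨k, rfl⟩ := hH
      exact hchar k
    | zero => simp
    | add H K _ _ hH hK =>
      simp only [ContinuousMap.add_apply, Finset.sum_add_distrib, add_div, map_add, mul_add]
      exact hH.add hK
    | smul a H _ hH =>
      simp only [ContinuousMap.smul_apply, smul_eq_mul, ← Finset.mul_sum, map_smul, mul_div_assoc,
        mul_left_comm _ a]
      exact hH.const_mul a
  rw [Metric.tendsto_nhds]
  intro ε hε
  have hG : G ∈ closure (Submodule.span ℂ (Set.range (mFourier (d := Fin 2))) : Set _) := by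
    rw [← Submodule.topologicalClosure_coe, span_mFourier_closure_eq_top]
    trivial
  -- Both `π` and, eventually, the number of points over `r²` are below `4`, so each replacement of
  -- `G` by `H` costs at most `4 · ε / 12 = ε / 3`.
  obtain ⟨H, hH, hGH⟩ := Metric.mem_closure_iff.1 hG (ε / 12) (by positivity)
  rw [dist_eq_norm] at hGH
  filter_upwards [Metric.tendsto_nhds.1 (hspan H hH) (ε / 3) (by positivity),
    tendsto_card_latticeBall.eventually_lt_const pi_lt_four] with r hr hcard
  have h1 : ‖(∑ m ∈ latticeBall r, G (toTorus (C (integerPoint m)))) / (r : ℂ) ^ 2 -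
      (∑ m ∈ latticeBall r, H (toTorus (C (integerPoint m)))) / (r : ℂ) ^ 2‖ ≤ ε / 3 := by
    rw [← sub_div, ← Finset.sum_sub_distrib, norm_div, norm_pow, Complex.norm_real,
      Real.norm_eq_abs, sq_abs]
    have h2 : ‖∑ m ∈ latticeBall r,
        (G (toTorus (C (integerPoint m))) - H (toTorus (C (integerPoint m))))‖ ≤
        (latticeBall r).card * (ε / 12) := by
      refine (norm_sum_le_of_le _ fun m _ =>
        ((G - H).norm_coe_le_norm (toTorus (C (integerPoint m)))).trans hGH.le).trans_eq ?_
      rw [Finset.sum_const, nsmul_eq_mul]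
    refine (div_le_div_of_nonneg_right h2 (sq_nonneg r)).trans ?_
    rw [mul_div_right_comm]
    nlinarith
  have h2 : ‖(π : ℂ) * torusMean H - π * torusMean G‖ < ε / 3 := by
    rw [← mul_sub, ← map_sub, norm_mul, Complex.norm_real, Real.norm_of_nonneg pi_nonneg]
    have := (norm_torusMean_le (H - G)).trans_eq (norm_sub_rev H G)
    nlinarith [pi_lt_four, pi_pos, norm_nonneg (torusMean (H - G))]
  rw [dist_eq_norm] at hr ⊢
  have h3 := norm_add₃_le
    (a := (∑ m ∈ latticeBall r, G (toTorus (C (integerPoint m)))) / (r : ℂ) ^ 2 -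
      (∑ m ∈ latticeBall r, H (toTorus (C (integerPoint m)))) / (r : ℂ) ^ 2)
    (b := (∑ m ∈ latticeBall r, H (toTorus (C (integerPoint m)))) / (r : ℂ) ^ 2 -
      π * torusMean H) (c := π * torusMean H - π * torusMean G)
  rw [sub_add_sub_cancel, sub_add_sub_cancel] at h3
  linarith

/-! ### Double sums over pairs of lattices -/

/-- If `ψ` is supported in the ball of radius `s` and `‖m‖ ≤ r - s`, every nonzero term of the
periodization has `‖n‖ ≤ r`, so nothing is lost. The other `m` lie in an annulus, and each costs at
most the supremum of the periodization of `‖ψ‖`. -/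
theorem tendsto_double_sum_sub {ψ : Plane → ℂ} (hψ : Continuous ψ) (hc : HasCompactSupport ψ)
    (C : Plane ≃ₗᵢ[ℝ] Plane) :
    Tendsto (fun r : ℝ => (∑ m ∈ latticeBall r,
      (∑ n ∈ latticeBall r, ψ (C (integerPoint m) + integerPoint n) -
        periodization ψ (C (integerPoint m)))) / (r : ℂ) ^ 2) atTop (𝓝 0) := by
  have hd := HasQuarticDecay.of_hasCompactSupport hψ hc
  have hd' : HasQuarticDecay fun x => ((‖ψ x‖ : ℝ) : ℂ) := by
    obtain ⟨K, hK, h⟩ := hd.exists_bound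
    exact ⟨by fun_prop, K, hK, fun x => by simpa using h x⟩
  obtain ⟨s, hs⟩ := hc.isCompact.isBounded.subset_closedBall (0 : Plane)
  let M := ‖torusPeriodization _ hd'‖
  have hM : ∀ x, ∑' n, ‖ψ (x + integerPoint n)‖ ≤ M := fun x => by
    have h := (torusPeriodization _ hd').norm_coe_le_norm (toTorus x)
    rw [torusPeriodization_toTorus, periodization, ← Complex.ofReal_tsum, Complex.norm_real] at h
    exact (Real.le_norm_self _).trans h
  have hout : ∀ x (T : Finset (Fin 2 → ℤ)),
      ‖∑ n ∈ T, ψ (x + integerPoint n) - periodization ψ x‖ ≤ M := fun x T => by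
    classical
    have h := (hd.summable_add x).sum_add_tsum_compl (s := T)
    rw [periodization, ← h, sub_add_cancel_left, norm_neg]
    refine (norm_tsum_le_tsum_norm ((hd.summable_add x).norm.subtype _)).trans ?_
    refine le_trans ?_ (hM x)
    exact (hd.summable_add x).norm.tsum_subtype_le _ _ fun n => norm_nonneg _
  have hin : ∀ r, ∀ m ∈ latticeBall (r - s),
      ∑ n ∈ latticeBall r, ψ (C (integerPoint m) + integerPoint n) -
        periodization ψ (C (integerPoint m)) = 0 := by
    intro r m hm
    rw [sub_eq_zero, periodization, tsum_eq_sum]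
    intro n hn
    rw [mem_latticeBall] at hm hn
    by_contra h
    have h1 := hs (subset_tsupport _ h)
    rw [mem_closedBall_zero_iff] at h1
    have h2 : ‖integerPoint n‖ ≤ ‖C (integerPoint m) + integerPoint n‖ + ‖C (integerPoint m)‖ := by
      simpa using norm_sub_le (C (integerPoint m) + integerPoint n) (C (integerPoint m))
    rw [C.norm_map] at h2
    linarith
  -- The radius `s` may be negative when the support is empty; `|s|` keeps the inner ball inside the
  -- outer one.
  have hs0 : ∀ r, latticeBall (r - |s|) ⊆ latticeBall (r - s) := fun r =>
    latticeBall_mono (sub_le_sub_left (le_abs_self s) r)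
  refine tendsto_average_of_forall_norm_le (c := |s|) (M := M) fun r => ?_
  have h := norm_sum_sub_sum_latticeBall_le (r := r)
    (latticeBall_mono (sub_le_self r (abs_nonneg s))) rfl
    (fun m => hout (C (integerPoint m)) (latticeBall r))
  rwa [Finset.sum_eq_zero fun m hm => hin r m (hs0 r hm), sub_zero] at h

/-- Pulling back by `B` turns the summand into `(φ ∘ B) (B⁻¹ A m - n)`, and `n ↦ -n` preserves the
ball. -/
theorem tendsto_double_sum {φ : Plane → ℂ} (hφ : Continuous φ) (hc : HasCompactSupport φ)
    (A B : Plane ≃ₗᵢ[ℝ] Plane) {L : ℂ}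
    (hL : Tendsto (fun r : ℝ => (∑ m ∈ latticeBall r,
      periodization (φ ∘ B) (B.symm (A (integerPoint m)))) / (r : ℂ) ^ 2) atTop (𝓝 L)) :
    Tendsto (fun r : ℝ => (∑ m ∈ latticeBall r, ∑ n ∈ latticeBall r,
      φ (A (integerPoint m) - B (integerPoint n))) / (r : ℂ) ^ 2) atTop (𝓝 L) := by
  have h := (tendsto_double_sum_sub (hφ.comp B.continuous)
    (hc.comp_homeomorph B.toHomeomorph) (A.trans B.symm)).add hL
  rw [zero_add] at h
  refine h.congr fun r => ?_
  rw [← add_div]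
  congr 1
  rw [Finset.sum_sub_distrib]
  simp only [LinearIsometryEquiv.trans_apply]
  rw [sub_add_cancel]
  refine Finset.sum_congr rfl fun m _ => ?_
  refine Finset.sum_bij' (fun n _ => -n) (fun n _ => -n) ?_ ?_ ?_ ?_ ?_
  · intro n hn
    simpa [integerPoint_neg] using hn
  · intro n hn
    simpa [integerPoint_neg] using hn
  · simp
  · simp
  · intro n _
    simp [integerPoint_neg]

theorem tendsto_double_sum_self {φ : Plane → ℂ} (hφ : Continuous φ) (hc : HasCompactSupport φ)
    (R : SO2) :
    Tendsto (fun r : ℝ => (∑ m ∈ latticeBall r, ∑ n ∈ latticeBall r,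
      φ (rotateIsometry R (integerPoint m) - rotateIsometry R (integerPoint n))) / (r : ℂ) ^ 2)
      atTop (𝓝 (π * ∫ x, φ x ∂(diracComb (rotatedLattice R)))) := by
  refine tendsto_double_sum hφ hc _ _ ?_
  have hd := HasQuarticDecay.of_hasCompactSupport hφ hc
  have hp : ∀ m, periodization (φ ∘ rotateIsometry R) (integerPoint m) =
      ∫ x, φ x ∂(diracComb (rotatedLattice R)) := fun m => by
    rw [← (hasSum_integral_diracComb R hd).tsum_eq, ← zero_add (integerPoint m),
      periodization_add_integerPoint, periodization]
    simp
  simp only [LinearIsometryEquiv.symm_apply_apply, hp, Finset.sum_const, nsmul_eq_mul]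
  have := ((Complex.continuous_ofReal.tendsto _).comp tendsto_card_latticeBall).mul_const
    (∫ x, φ x ∂(diracComb (rotatedLattice R)))
  refine this.congr fun r => ?_
  simp only [Function.comp_apply]
  push_cast
  ring

/-- An integer vector `S⁻¹ R n = k ≠ 0` would give the nonzero common point `S k = R n`; this is the
hypothesis needed for equidistribution. -/
theorem tendsto_double_sum_of_inter_eq {φ : Plane → ℂ} (hφ : Continuous φ)
    (hc : HasCompactSupport φ) {R S : SO2} (hRS : rotatedLattice R ∩ rotatedLattice S = {0}) :
    Tendsto (fun r : ℝ => (∑ m ∈ latticeBall r, ∑ n ∈ latticeBall r,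
      φ (rotateIsometry R (integerPoint m) - rotateIsometry S (integerPoint n))) / (r : ℂ) ^ 2)
      atTop (𝓝 (π * ∫ x, φ x)) := by
  refine tendsto_double_sum hφ hc _ _ ?_
  have hd := (HasQuarticDecay.of_hasCompactSupport hφ hc).comp_isometry (rotateIsometry S)
  have h := tendsto_average_torus ((rotateIsometry R).trans (rotateIsometry S).symm) ?_
    (torusPeriodization _ hd)
  · rw [torusMean_torusPeriodization] at h
    have hint : ∫ x, (φ ∘ rotateIsometry S) x = ∫ x, φ x :=
      (rotateIsometry S).measurePreserving.integral_comp
        (rotateIsometry S).toHomeomorph.measurableEmbedding φ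
    rw [hint] at h
    simpa only [torusPeriodization_toTorus, LinearIsometryEquiv.trans_apply] using h
  · rintro k hk ⟨n, hn⟩
    have h1 : rotateIsometry S (integerPoint k) = rotateIsometry R (integerPoint n) := by
      rw [hn]
      simp
    have h2 : rotateIsometry S (integerPoint k) ∈ rotatedLattice R ∩ rotatedLattice S := by
      rw [rotatedLattice_eq_range, rotatedLattice_eq_range]
      exact ⟨⟨n, h1.symm⟩, ⟨k, rfl⟩⟩
    rw [hRS, Set.mem_singleton_iff] at h2
    have h3 := (map_eq_zero_iff _ (rotateIsometry S).injective).1 h2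
    rw [← integerPoint_zero] at h3
    exact hk (integerPoint_injective h3)

/-! ### The autocorrelation -/

theorem diracComb_restrict_closedBall (R : SO2) (r : ℝ) :
    (diracComb (rotatedLattice R)).restrict (Metric.closedBall 0 r) =
      ∑ n ∈ latticeBall r, Measure.dirac (rotateIsometry R (integerPoint n)) := by
  classical
  have hm : MeasurableSet (Metric.closedBall (0 : Plane) r) :=
    Metric.isClosed_closedBall.measurableSet
  rw [diracComb_rotatedLattice, Measure.restrict_sum _ hm]
  ext s hs
  rw [Measure.sum_apply _ hs, Measure.coe_finsetSum, Finset.sum_apply, tsum_eq_sum]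
  · refine Finset.sum_congr rfl fun n hn => ?_
    rw [restrict_dirac' hm, if_pos]
    simpa [norm_rotate] using hn
  · intro n hn
    rw [restrict_dirac' hm, if_neg]
    · simp
    · simpa [norm_rotate] using hn

theorem averagedComb_restrict_closedBall {N : ℕ} (R : Fin N → SO2) (r : ℝ) :
    (averagedComb R).restrict (Metric.closedBall 0 r) = (1 / N : ℝ≥0) •
      ∑ j, ∑ n ∈ latticeBall r, Measure.dirac (rotateIsometry (R j) (integerPoint n)) := by
  rw [averagedComb, Measure.restrict_smul, ← Measure.restrictₗ_apply, map_sum]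
  simp only [Measure.restrictₗ_apply, diracComb_restrict_closedBall]

theorem integral_averagedComb_restrict_closedBall {N : ℕ} (R : Fin N → SO2) (r : ℝ)
    (g : Plane → ℂ) :
    ∫ x, g x ∂((averagedComb R).restrict (Metric.closedBall 0 r)) =
      (1 / N : ℂ) * ∑ j, ∑ n ∈ latticeBall r, g (rotateIsometry (R j) (integerPoint n)) := by
  have hd : ∀ x, Integrable g (Measure.dirac x) := fun x => integrable_dirac (by simp)
  rw [averagedComb_restrict_closedBall, integral_smul_nnreal_measure,
    integral_finsetSum_measure fun j _ => integrable_finsetSum_measure.2 fun n _ => hd _]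
  simp only [integral_finsetSum_measure fun n _ => hd _, integral_dirac, NNReal.smul_def,
    Complex.real_smul]
  push_cast
  rfl

instance {N : ℕ} (R : Fin N → SO2) (r : ℝ) :
    IsFiniteMeasure ((averagedComb R).restrict (Metric.closedBall 0 r)) := by
  rw [averagedComb_restrict_closedBall]
  infer_instance

theorem isFiniteMeasure_finiteAutocorrelation {N : ℕ} (R : Fin N → SO2) {r : ℝ} (hr : 0 < r) :
    IsFiniteMeasure (finiteAutocorrelation (averagedComb R) r) := by
  have : IsFiniteMeasure (((averagedComb R).restrict (Metric.closedBall 0 r)).map fun x => -x) :=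
    inferInstance
  exact Measure.smul_finite _ (ENNReal.inv_ne_top.2 (Metric.measure_closedBall_pos _ _ hr).ne')

theorem integral_finiteAutocorrelation {N : ℕ} (R : Fin N → SO2) {φ : Plane → ℂ}
    (hφ : Continuous φ) (hc : HasCompactSupport φ) {r : ℝ} (hr : 0 < r) :
    ∫ x, φ x ∂(finiteAutocorrelation (averagedComb R) r) =
      ∑ j, ∑ k, (1 / (N : ℂ) ^ 2) * (π : ℂ)⁻¹ * ((∑ m ∈ latticeBall r, ∑ n ∈ latticeBall r,
        φ (rotateIsometry (R j) (integerPoint m) - rotateIsometry (R k) (integerPoint n))) /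
          (r : ℂ) ^ 2) := by
  have hint : ∀ μ : Measure Plane, IsFiniteMeasure μ → Integrable φ μ := fun μ _ => by
    obtain ⟨K, hK⟩ := hc.exists_bound_of_continuous hφ
    exact Integrable.of_bound hφ.aestronglyMeasurable K (ae_of_all _ hK)
  have hmap : ∀ x, ∫ y, φ (x + y) ∂(((averagedComb R).restrict
      (Metric.closedBall 0 r)).map fun x => -x) =
      (1 / N : ℂ) * ∑ k, ∑ n ∈ latticeBall r, φ (x - rotateIsometry (R k) (integerPoint n)) := by
    intro x
    rw [integral_map (by fun_prop) (by fun_prop), integral_averagedComb_restrict_closedBall]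
    simp only [← sub_eq_add_neg]
  rw [finiteAutocorrelation, integral_smul_measure, integral_conv (hint _ inferInstance)]
  simp only [hmap]
  rw [integral_averagedComb_restrict_closedBall, EuclideanSpace.volume_closedBall_fin_two]
  simp only [ENNReal.toReal_inv, ENNReal.toReal_mul, ENNReal.toReal_pow,
    ENNReal.toReal_ofReal hr.le, ENNReal.toReal_ofReal pi_nonneg, Complex.real_smul]
  push_cast
  simp only [Finset.mul_sum, Finset.sum_div]
  refine Finset.sum_congr rfl fun j _ => ?_
  rw [Finset.sum_comm]
  refine Finset.sum_congr rfl fun k _ => Finset.sum_congr rfl fun m _ =>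
    Finset.sum_congr rfl fun n _ => ?_
  rw [mul_inv]
  ring

theorem integral_combAutocorrelation {N : ℕ} (hN : 1 ≤ N) (R : Fin N → SO2) {φ : Plane → ℂ}
    (hφ : HasQuarticDecay φ) :
    ∫ x, φ x ∂(combAutocorrelation R) = ((N - 1) / N : ℂ) * (∫ x, φ x) +
      ∑ j, (1 / (N : ℂ) ^ 2) * ∫ x, φ x ∂(diracComb (rotatedLattice (R j))) := by
  -- Subtraction in `ℝ≥0` is truncated; `N ≥ 1` makes `N - 1` agree with the complex difference.
  have hN' : (1 : ℝ≥0) ≤ N := by exact_mod_cast hN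
  have hd : ∀ j, Integrable φ ((1 / (N : ℝ≥0) ^ 2) • diracComb (rotatedLattice (R j))) :=
    fun j => (integrable_diracComb (R j) hφ).smul_measure_nnreal
  rw [combAutocorrelation, integral_add_measure hφ.integrable.smul_measure_nnreal
    (integrable_finsetSum_measure.2 fun j _ => hd j), integral_finsetSum_measure fun j _ => hd j]
  simp only [integral_smul_nnreal_measure, NNReal.smul_def, Complex.real_smul]
  push_cast [NNReal.coe_sub hN']
  rfl

theorem isAutocorrelation_averagedComb {N : ℕ} (hN : 1 ≤ N) (R : Fin N → SO2)
    (hR : ∀ j k, j ≠ k → rotatedLattice (R j) ∩ rotatedLattice (R k) = {0}) :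
    IsAutocorrelation (averagedComb R) (combAutocorrelation R) := by
  classical
  refine ⟨?_, isLocallyFiniteMeasure_of_hasTemperateGrowth inferInstance, fun φ hφ hc => ?_⟩
  · filter_upwards [eventually_gt_atTop 0] with r hr
    have := isFiniteMeasure_finiteAutocorrelation R hr
    infer_instance
  have hφ' : Continuous fun x => (φ x : ℂ) := by fun_prop
  have hc' : HasCompactSupport fun x => (φ x : ℂ) := hc.comp_left (g := Complex.ofReal) rfl
  have hN0 : (N : ℂ) ≠ 0 := by exact_mod_cast (by omega : N ≠ 0)
  have hpi : (π : ℂ) ≠ 0 := by exact_mod_cast pi_ne_zero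
  let L : Fin N → Fin N → ℂ := fun j k => if j = k then
    ∫ x, (φ x : ℂ) ∂(diracComb (rotatedLattice (R j))) else ∫ x, (φ x : ℂ)
  have hL : ∀ j k, Tendsto (fun r : ℝ => (∑ m ∈ latticeBall r, ∑ n ∈ latticeBall r,
      (φ (rotateIsometry (R j) (integerPoint m) - rotateIsometry (R k) (integerPoint n)) : ℂ)) /
        (r : ℂ) ^ 2) atTop (𝓝 (π * L j k)) := by
    intro j k
    by_cases h : j = k
    · subst h
      simpa only [L, if_true] using tendsto_double_sum_self hφ' hc' (R j)
    · simpa only [L, if_neg h] using tendsto_double_sum_of_inter_eq hφ' hc' (hR j k h)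
  have hlim := tendsto_finsetSum Finset.univ fun j _ => tendsto_finsetSum Finset.univ fun k _ =>
    (hL j k).const_mul ((1 / (N : ℂ) ^ 2) * (π : ℂ)⁻¹)
  have hval : ∑ j, ∑ k, (1 / (N : ℂ) ^ 2) * (π : ℂ)⁻¹ * (π * L j k) =
      ∫ x, (φ x : ℂ) ∂(combAutocorrelation R) := by
    rw [integral_combAutocorrelation hN R (HasQuarticDecay.of_hasCompactSupport hφ' hc')]
    have h1 : ∀ j, ∑ k, (1 / (N : ℂ) ^ 2) * (π : ℂ)⁻¹ * (π * L j k) =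
        (1 / (N : ℂ) ^ 2) * ((N - 1) * ∫ x, (φ x : ℂ)) +
          (1 / (N : ℂ) ^ 2) * ∫ x, (φ x : ℂ) ∂(diracComb (rotatedLattice (R j))) := by
      intro j
      -- Each row has one diagonal entry and `N - 1` equal off-diagonal ones.
      have h2 : ∑ k, L j k = (N - 1) * (∫ x, (φ x : ℂ)) +
          ∫ x, (φ x : ℂ) ∂(diracComb (rotatedLattice (R j))) := by
        rw [← Finset.sum_erase_add _ _ (Finset.mem_univ j)]
        have h3 : ∀ k ∈ Finset.univ.erase j, L j k = ∫ x, (φ x : ℂ) := fun k hk =>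
          if_neg (Finset.ne_of_mem_erase hk).symm
        rw [Finset.sum_congr rfl h3, Finset.sum_const, Finset.card_erase_of_mem (Finset.mem_univ j),
          Finset.card_univ, Fintype.card_fin, nsmul_eq_mul, Nat.cast_sub hN, Nat.cast_one]
        simp only [L, if_true]
      rw [← mul_add, ← h2, Finset.mul_sum]
      refine Finset.sum_congr rfl fun k _ => ?_
      field_simp
    simp only [h1]
    rw [Finset.sum_add_distrib, Finset.sum_const, Finset.card_univ, Fintype.card_fin, nsmul_eq_mul]
    congr 1
    field_simp
  rw [hval, integral_complex_ofReal] at hlim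
  have hre := (Complex.continuous_re.tendsto _).comp hlim
  rw [Complex.ofReal_re] at hre
  refine hre.congr' ?_
  filter_upwards [eventually_gt_atTop 0] with r hr
  rw [Function.comp_apply, ← integral_finiteAutocorrelation R hφ' hc' hr, integral_complex_ofReal,
    Complex.ofReal_re]

/-! ### Fourier transforms and limits of the measures -/

/-- This is Fourier inversion at the origin. -/
theorem fourier_volume_plane :
    𝓕 (volume : Measure Plane).toTemperedDistribution =
      (Measure.dirac (0 : Plane)).toTemperedDistribution := by
  rw [TemperedDistribution.toTemperedDistribution_dirac_eq_delta]
  ext g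
  change ∫ x, (𝓕 g) x = g 0
  have h : 𝓕⁻ (𝓕 g) = g := FourierTransform.fourierInv_fourier_eq g
  conv_rhs => rw [← h]
  rw [SchwartzMap.fourierInv_coe, Real.fourierInv_eq]
  simp

theorem toTemperedDistribution_combAutocorrelation {N : ℕ} (hN : 1 ≤ N) (R : Fin N → SO2) :
    (combAutocorrelation R).toTemperedDistribution =
      (((N : ℂ) - 1) / N) • (volume : Measure Plane).toTemperedDistribution +
        (1 / N : ℂ) • ((1 / N : ℂ) •
          ∑ j, (diracComb (rotatedLattice (R j))).toTemperedDistribution) := by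
  ext g
  change ∫ x, g x ∂(combAutocorrelation R) = ((N - 1) / N : ℂ) * (∫ x, g x) +
    (1 / N : ℂ) * ((1 / N : ℂ) * (∑ j, (diracComb (rotatedLattice (R j))).toTemperedDistribution) g)
  rw [integral_combAutocorrelation hN R g.hasQuarticDecay, ← Finset.mul_sum,
    ← mul_assoc (1 / N : ℂ)]
  congr 1
  rw [one_div_mul_one_div, ← sq]
  congr 1
  simp

theorem fourier_combAutocorrelation {N : ℕ} (hN : 1 ≤ N) (R : Fin N → SO2) :
    𝓕 (combAutocorrelation R).toTemperedDistribution =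
      (((N : ℂ) - 1) / N) • (Measure.dirac (0 : Plane)).toTemperedDistribution +
        (1 / N : ℂ) • ((1 / N : ℂ) •
          ∑ j, 𝓕 (diracComb (rotatedLattice (R j))).toTemperedDistribution) := by
  rw [toTemperedDistribution_combAutocorrelation hN, FourierTransform.fourier_add,
    FourierTransform.fourier_smul, FourierTransform.fourier_smul, FourierTransform.fourier_smul,
    FourierTransform.fourier_sum, fourier_volume_plane]

theorem isFourierTransform_combAutocorrelation {N : ℕ} (hN : 1 ≤ N) (R : Fin N → SO2) :
    IsFourierTransform (combAutocorrelation R)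
      ((((N : ℝ≥0) - 1) / N) • Measure.dirac (0 : Plane) +
        (1 / N : ℝ≥0) • ((1 / N : ℝ≥0) • ∑ j, diracComb (rotatedLattice (R j)))) := by
  have ht : ((((N : ℝ≥0) - 1) / N) • Measure.dirac (0 : Plane) +
      (1 / N : ℝ≥0) • ((1 / N : ℝ≥0) • ∑ j, diracComb (rotatedLattice (R j)))).HasTemperateGrowth :=
    temperate_add (temperate_smul inferInstance _)
      (temperate_smul (temperate_smul (temperate_sum _ fun _ => inferInstance) _) _)
  refine ⟨inferInstance, ht, ?_⟩
  rw [fourier_combAutocorrelation hN]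
  simp only [fourier_diracComb]
  have hN' : (1 : ℝ≥0) ≤ N := by exact_mod_cast hN
  ext g
  have hi := fun j => integrable_diracComb (R j) g.hasQuarticDecay
  have hs := integrable_finsetSum_measure.2 fun j (_ : j ∈ Finset.univ) => hi j
  change ((N - 1) / N : ℂ) * (∫ x, g x ∂(Measure.dirac (0 : Plane))) +
    (1 / N : ℂ) * ((1 / N : ℂ) * (∑ j, (diracComb (rotatedLattice (R j))).toTemperedDistribution) g)
    = ∫ x, g x ∂((((N : ℝ≥0) - 1) / N) • Measure.dirac (0 : Plane) +
        (1 / N : ℝ≥0) • ((1 / N : ℝ≥0) • ∑ j, diracComb (rotatedLattice (R j))))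
  rw [integral_add_measure (integrable_dirac (by simp)).smul_measure_nnreal
    hs.smul_measure_nnreal.smul_measure_nnreal]
  simp only [integral_smul_nnreal_measure, NNReal.smul_def, Complex.real_smul]
  rw [integral_finsetSum_measure fun j _ => hi j]
  push_cast [NNReal.coe_sub hN']
  simp

theorem tendsto_average_fourier_diracComb {R : ℕ → SO2} {x : Plane} (hx : ‖x‖ = 1)
    (hu : IsUniformlyDistributedOnUnitCircle fun j => rotate (R j) x)
    [radialComb.HasTemperateGrowth] :
    Tendsto (fun N : ℕ => (1 / N : ℂ) • ∑ j ∈ Finset.range N,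
        𝓕 (diracComb (rotatedLattice (R j))).toTemperedDistribution)
      atTop (𝓝 radialComb.toTemperedDistribution) := by
  simp only [fourier_diracComb]
  rw [PointwiseConvergenceCLM.tendsto_iff_forall_tendsto]
  intro g
  refine (tendsto_average_integral_diracComb hx hu g.hasQuarticDecay).congr fun N => ?_
  simp

theorem vagueTendsto_average_diracComb {R : ℕ → SO2} {x : Plane} (hx : ‖x‖ = 1)
    (hu : IsUniformlyDistributedOnUnitCircle fun j => rotate (R j) x) :
    VagueTendsto
      (fun N : ℕ => (1 / N : ℝ≥0) • ∑ j ∈ Finset.range N, diracComb (rotatedLattice (R j)))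
      atTop radialComb := by
  refine ⟨Eventually.of_forall fun N => isLocallyFiniteMeasure_of_hasTemperateGrowth
    (temperate_smul (temperate_sum _ fun _ => inferInstance) _),
    isLocallyFiniteMeasure_of_hasTemperateGrowth hasTemperateGrowth_radialComb,
    fun φ hφ hc => ?_⟩
  have hd : HasQuarticDecay fun x => (φ x : ℂ) :=
    .of_hasCompactSupport (by fun_prop) (hc.comp_left (g := Complex.ofReal) rfl)
  have h := (Complex.continuous_re.tendsto _).comp (tendsto_average_integral_diracComb hx hu hd)
  rw [integral_complex_ofReal, Complex.ofReal_re] at h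
  refine h.congr fun N => ?_
  rw [Function.comp_apply, integral_smul_nnreal_measure, integral_finsetSum_measure fun j _ => by
    simpa using (integrable_diracComb (R j) hd).re]
  simp only [integral_complex_ofReal, NNReal.smul_def, smul_eq_mul]
  rw [← Complex.ofReal_re ((((1 / N : ℝ≥0) : ℝ)) * _)]
  push_cast
  rfl

theorem mainTheorem5 :
    -- finitely many lattices: autocorrelation and diffraction
    (∀ (N : ℕ) (_ : 1 ≤ N) (R : Fin N → SO2)
      (_ : ∀ j k, j ≠ k → rotatedLattice (R j) ∩ rotatedLattice (R k) = {0}),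
      IsAutocorrelation (averagedComb R) (combAutocorrelation R) ∧
      𝓕 (combAutocorrelation R).toTemperedDistribution =
        (((N : ℂ) - 1) / N) • (Measure.dirac (0 : Plane)).toTemperedDistribution +
          (1 / N : ℂ) • ((1 / N : ℂ) •
            ∑ j, 𝓕 (diracComb (rotatedLattice (R j))).toTemperedDistribution) ∧
      ∃ ν : Fin N → Measure Plane,
        (∀ j, IsFourierTransform (diracComb (rotatedLattice (R j))) (ν j)) ∧
        IsFourierTransform (combAutocorrelation R)
          ((((N : ℝ≥0) - 1) / N) • Measure.dirac (0 : Plane) +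
            (1 / N : ℝ≥0) • ((1 / N : ℝ≥0) • ∑ j, ν j))) ∧
    -- sequences of lattices: the limit of the bracketed averages
    (∀ (R : ℕ → SO2)
      (_ : ∀ j k, j ≠ k → rotatedLattice (R j) ∩ rotatedLattice (R k) = {0})
      (x : Plane) (_ : ‖x‖ = 1)
      (_ : IsUniformlyDistributedOnUnitCircle fun j => rotate (R j) x),
      (∃ _ : radialComb.HasTemperateGrowth,
        Tendsto (fun N : ℕ => (1 / N : ℂ) • ∑ j ∈ Finset.range N,
            𝓕 (diracComb (rotatedLattice (R j))).toTemperedDistribution)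
          atTop (𝓝 radialComb.toTemperedDistribution)) ∧
      ∃ ν : ℕ → Measure Plane,
        (∀ j, IsFourierTransform (diracComb (rotatedLattice (R j))) (ν j)) ∧
        VagueTendsto (fun N : ℕ => (1 / N : ℝ≥0) • ∑ j ∈ Finset.range N, ν j)
          atTop radialComb) := by
  -- By Poisson summation the combs themselves serve as the transforms `ν j`.
  refine ⟨fun N hN R hR => ⟨isAutocorrelation_averagedComb hN R hR,
    fourier_combAutocorrelation hN R, fun j => diracComb (rotatedLattice (R j)),
    fun j => isFourierTransform_diracComb (R j), isFourierTransform_combAutocorrelation hN R⟩,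
    fun R _ x hx hu => ⟨⟨hasTemperateGrowth_radialComb, ?_⟩,
      fun j => diracComb (rotatedLattice (R j)), fun j => isFourierTransform_diracComb (R j),
      vagueTendsto_average_diracComb hx hu⟩⟩
  have := hasTemperateGrowth_radialComb
  exact tendsto_average_fourier_diracComb hx hu
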